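/- Consider bootstrap percolation with threshold $2$ on the $d$-dimensional Hamming torus: the vertex set is $[n]^d$, two vertices are adjacent if they differ in exactly one coordinate, and at each step every open vertex stays open while a closed vertex becomes open if at least $2$ of its neighbors are open. For $S\subseteq[n]^d$ let $\langle S\rangle$ be the set of vertices that are eventually open when $S$ is the initial set of open vertices. A subtorus of dimension $i$ is a set $V\subseteq[n]^d$ obtained by prescribing the values of some $d-i$ of the coordinates; it is internally spanned by $\omega_0$ if $\langle\omega_0\cap V\rangle=V$. Let $\mathbb P_p$ be the law of the random initial set $\omega_0$ that contains each vertex independently with probability $p$, and let $\mathcal I_i$ be the event that some subtorus of dimension $i$ is internally spanned by $\omega_0$. **Theorem.** Fix an integer $J\ge 1$ and a real $a>0$, and let $d=(J+1)(J+2)$ and $p=p(n)=a\,n^{-2J-2}$ (for $n$ large enough that $p\le 1$). If $J>1$, then $$\mathbb P_p(\mathcal I_d\setminus\mathcal I_{2J+2})\to 0\quad\text{as } n\to\infty.$$ If $J=1$ (so $d=6$ and $p=a\,n^{-4}$), then there is a constant $c>0$, which may depend on $a$ but not on $n$, such that for all sufficiently large $n$ $$\mathbb P_p(\mathcal I_6\setminus\mathcal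 I_4)>c.$$ -/

import Mathlib

open Filter Topology MeasureTheory ProbabilityTheory

namespace HammingBootstrap

/-- One step of bootstrap percolation on `G` with threshold `θ`; a configuration is identified with
its set of open vertices. A vertex is open after the step if it was open before, or if at least `θ`
of its neighbors were. -/
def step {V : Type*} (G : SimpleGraph V) (θ : ℕ) (ω : Set V) : Set V :=
  {v | v ∈ ω ∨ (θ : ℕ∞) ≤ (G.neighborSet v ∩ ω).encard}

/-- The configuration at time `t`, started from `ω₀`. -/
def config {V : Type*} (G : SimpleGraph V) (θ : ℕ) (ω₀ : Set V) (t : ℕ) : Set V :=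
  (step G θ)^[t] ω₀

/-- The set of eventually open vertices, started from `ω₀`. -/
def eventuallyOpen {V : Type*} (G : SimpleGraph V) (θ : ℕ) (ω₀ : Set V) : Set V :=
  ⋃ t : ℕ, config G θ ω₀ t

/-- The vertex set `[n]^d`. -/
abbrev Node (d n : ℕ) : Type := Fin d → Fin n

/-- The `d`-dimensional Hamming torus: two nodes are adjacent if they differ in exactly one
coordinate. -/
def hammingTorus (d n : ℕ) : SimpleGraph (Node d n) where
  Adj v w := hammingDist v w = 1
  symm := ⟨fun v w h => by rw [hammingDist_comm]; exact h⟩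
  loopless := ⟨fun v h => by simp at h⟩

/-- The span of a set of nodes: the eventually open set for threshold `2`. -/
def span {d n : ℕ} (S : Set (Node d n)) : Set (Node d n) :=
  eventuallyOpen (hammingTorus d n) 2 S

/-- `V` belongs to the collection `𝓕 i` of subtori of dimension `i`: it consists of all nodes whose
coordinates in some set `I` of `d - i` indices take prescribed values. -/
def IsSubtorus {d n : ℕ} (i : ℕ) (V : Set (Node d n)) : Prop :=
  ∃ (I : Finset (Fin d)) (α : Fin d → Fin n), I.card + i = d ∧ V = {v | ∀ l ∈ I, v l = α l}

/-- `V` is internally spanned by `S`. -/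
def InternallySpans {d n : ℕ} (S V : Set (Node d n)) : Prop :=
  V = span (S ∩ V)

/-- The event `𝓘 i` that the initial configuration internally spans some subtorus of
dimension `i`. -/
def spannedEvent (d n i : ℕ) : Set (Set (Node d n)) :=
  {ω₀ | ∃ V : Set (Node d n), IsSubtorus i V ∧ InternallySpans ω₀ V}

/-- The law of the initial configuration: each node is open with probability `p`,
independently. -/
noncomputable def initialLaw (d n : ℕ) (p : unitInterval) : Measure (Set (Node d n)) :=
  setBernoulli Set.univ p

end HammingBootstrap

/-! Two subtori at distance at most two fill the smallest subtorus containing both, whereas a union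
of subtori pairwise at distance greater than two is closed. So if the whole torus is spanned, it is
built by a binary tree of merges whose leaves are open nodes, with disjoint sets of nodes used on
the two sides of each merge (`exists_wit_univ`). A merge of dimensions `i₁` and `i₂` has dimension
at most `i₁ + i₂ + 2`.

For the upper bound, follow the tree down to the first step that exceeds dimension `2J`
(`Wit.exists_sub`). It yields dimension `2J + 1`, or `2J + 2` (excluded by the event), or jumps from
two subtori of dimension at most `2J` to dimension at least `2J + 3`. A first moment recursion
(`mergeWeight_le`, `exists_weight_le`) bounds the weight of a fixed subtorus of dimension `i ≤ 2J +
1` by a multiple of `n ^ weightExp J i`; the exponent comes from adding single nodes, each raising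
the dimension by two. After counting positions, dimension `2J + 1` contributes `O(1/n)` by parity
(`weightExp_two_mul_add_one`), and the jump contributes `O(1/n)` exactly because `J > 1`
(`weightExp_add_lt`).

For `J = 1` the jump 2 + 2 + 2 = 6 has exponent zero. The lower bound realizes it: two pairs of
nodes span two planes at distance two, and every other open node is too isolated to help. There are
order `n ^ 16` choices of the pairs against `p ^ 4`, the corresponding events are disjoint, and
Harris' inequality bounds the probability of isolation below by a constant. -/

namespace HammingBootstrap

/-! ### Closed sets and the merging of subtori -/

section Deterministic

variable {d n : ℕ}

/-- A set of nodes is closed if it contains every node with two distinct neighbors in it. -/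
def Closed (C : Set (Node d n)) : Prop :=
  ∀ v u w, u ∈ C → w ∈ C → u ≠ w → hammingDist v u = 1 → hammingDist v w = 1 → v ∈ C

theorem two_le_encard_neighborSet_iff (v : Node d n) (C : Set (Node d n)) :
    ((2 : ℕ) : ℕ∞) ≤ ((hammingTorus d n).neighborSet v ∩ C).encard ↔
      ∃ u w, u ∈ C ∧ w ∈ C ∧ u ≠ w ∧ hammingDist v u = 1 ∧ hammingDist v w = 1 := by
  have h2 : ((2 : ℕ) : ℕ∞) = 1 + 1 := by norm_num
  rw [h2, ENat.add_one_le_iff (by simp), Set.one_lt_encard_iff]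
  constructor
  · rintro ⟨u, w, ⟨hu, hu'⟩, ⟨hw, hw'⟩, huw⟩
    exact ⟨u, w, hu', hw', huw, hu, hw⟩
  · rintro ⟨u, w, hu', hw', huw, hu, hw⟩
    exact ⟨u, w, ⟨hu, hu'⟩, ⟨hw, hw'⟩, huw⟩

theorem config_subset_config_succ (S : Set (Node d n)) (t : ℕ) :
    config (hammingTorus d n) 2 S t ⊆ config (hammingTorus d n) 2 S (t + 1) := by
  intro v hv
  rw [config, Function.iterate_succ_apply']
  exact Or.inl hv

theorem subset_span (S : Set (Node d n)) : S ⊆ span S := fun _ hv =>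
  Set.mem_iUnion.2 ⟨0, hv⟩

theorem closed_span (S : Set (Node d n)) : Closed (span S) := by
  intro v u w hu hw huw hvu hvw
  obtain ⟨s, hs⟩ := Set.mem_iUnion.1 hu
  obtain ⟨t, ht⟩ := Set.mem_iUnion.1 hw
  have hmono := monotone_nat_of_le_succ (config_subset_config_succ S)
  refine Set.mem_iUnion.2 ⟨max s t + 1, ?_⟩
  rw [config, Function.iterate_succ_apply']
  exact Or.inr ((two_le_encard_neighborSet_iff _ _).2
    ⟨u, w, hmono (le_max_left s t) hs, hmono (le_max_right s t) ht, huw, hvu, hvw⟩)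

theorem span_subset {S C : Set (Node d n)} (hC : Closed C) (hS : S ⊆ C) : span S ⊆ C := by
  refine Set.iUnion_subset fun t => ?_
  induction t with
  | zero => exact hS
  | succ t ih =>
    intro v hv
    rw [config, Function.iterate_succ_apply'] at hv
    rcases hv with hv | hv
    · exact ih hv
    · obtain ⟨u, w, hu, hw, huw, hvu, hvw⟩ := (two_le_encard_neighborSet_iff _ _).1 hv
      exact hC v u w (ih hu) (ih hw) huw hvu hvw

/-- The subtorus through `v` with free coordinates `F`. -/
def subtorus (F : Finset (Fin d)) (v : Node d n) : Set (Node d n) :=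
  {u | ∀ l, l ∉ F → u l = v l}

theorem self_mem_subtorus (F : Finset (Fin d)) (v : Node d n) : v ∈ subtorus F v :=
  fun _ _ => rfl

theorem subtorus_subset_subtorus {F G : Finset (Fin d)} {u v : Node d n} (hFG : F ⊆ G)
    (hu : u ∈ subtorus G v) : subtorus F u ⊆ subtorus G v := fun _ hx l hl =>
  (hx l fun h => hl (hFG h)).trans (hu l hl)

theorem mem_subtorus_comm {F : Finset (Fin d)} {u v : Node d n} :
    u ∈ subtorus F v ↔ v ∈ subtorus F u :=
  ⟨fun h l hl => (h l hl).symm, fun h l hl => (h l hl).symm⟩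

theorem subtorus_eq {F : Finset (Fin d)} {u v : Node d n} (hu : u ∈ subtorus F v) :
    subtorus F u = subtorus F v :=
  (subtorus_subset_subtorus subset_rfl hu).antisymm
    (subtorus_subset_subtorus subset_rfl (mem_subtorus_comm.1 hu))

theorem isSubtorus_subtorus (F : Finset (Fin d)) (v : Node d n) :
    IsSubtorus F.card (subtorus F v) := by
  refine ⟨Fᶜ, v, ?_, ?_⟩
  · rw [Finset.card_compl, Fintype.card_fin]
    have := F.card_le_univ
    rw [Fintype.card_fin] at this
    omega
  · simp [subtorus]

theorem IsSubtorus.exists_eq {i : ℕ} {V : Set (Node d n)} (h : IsSubtorus i V) :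
    ∃ F v, F.card = i ∧ V = subtorus F v := by
  obtain ⟨I, α, hI, rfl⟩ := h
  refine ⟨Iᶜ, α, ?_, by simp [subtorus]⟩
  rw [Finset.card_compl, Fintype.card_fin]
  omega

theorem hammingDist_update_le (v : Node d n) (l : Fin d) (c : Fin n) :
    hammingDist v (Function.update v l c) ≤ 1 := by
  have : (Finset.univ.filter fun k => v k ≠ Function.update v l c k) ⊆ {l} := by
    intro k hk
    by_contra h
    simp only [Finset.mem_singleton] at h
    simp [h] at hk
  exact (Finset.card_le_card this).trans (by simp)

theorem hammingDist_update_eq (v : Node d n) (l : Fin d) (c : Fin n) (h : c ≠ v l) :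
    hammingDist v (Function.update v l c) = 1 := by
  refine le_antisymm (hammingDist_update_le v l c) ?_
  rw [Nat.one_le_iff_ne_zero, Ne, hammingDist_eq_zero]
  intro h'
  exact h (by simpa using (congrFun h' l).symm)

theorem mem_of_update_mem {C : Set (Node d n)} (hC : Closed C) {v : Node d n} {k l : Fin d}
    {b c : Fin n} (hb : Function.update v k b ∈ C) (hc : Function.update v l c ∈ C)
    (hbc : Function.update v k b ≠ Function.update v l c) : v ∈ C := by
  by_cases h1 : b = v k
  · simpa [h1] using hb
  by_cases h2 : c = v l
  · simpa [h2] using hc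
  exact hC v _ _ hb hc hbc (hammingDist_update_eq v k b h1) (hammingDist_update_eq v l c h2)

/-- A node outside the subtorus is wrong in some fixed coordinate `l`. A neighbor inside must
correct `l` and agree elsewhere, so there is at most one such neighbor. -/
theorem closed_subtorus (F : Finset (Fin d)) (v : Node d n) : Closed (subtorus F v) := by
  intro x u w hu hw huw hxu hxw l hl
  by_contra hne
  have aux : ∀ u : Node d n, u ∈ subtorus F v → hammingDist x u = 1 → ∀ k, k ≠ l → u k = x k := by
    intro u hu h k hk
    by_contra hne'
    obtain ⟨j, hj⟩ := Finset.card_eq_one.1 h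
    have h1 : k ∈ Finset.univ.filter fun k => x k ≠ u k := by simpa using Ne.symm hne'
    have h2 : l ∈ Finset.univ.filter fun k => x k ≠ u k := by simpa [hu l hl] using hne
    rw [hj, Finset.mem_singleton] at h1 h2
    exact hk (h1.trans h2.symm)
  refine huw (funext fun k => ?_)
  by_cases hk : k = l
  · rw [hk, hu l hl, hw l hl]
  · rw [aux u hu hxu k hk, aux w hw hxw k hk]

/-- A closed set containing a subtorus and a node at distance at most one from it contains the
subtorus that they generate. -/
theorem Closed.subtorus_insert_subset {C : Set (Node d n)} (hC : Closed C) {F : Finset (Fin d)}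
    {v : Node d n} (hv : subtorus F v ⊆ C) {l : Fin d} (hl : l ∉ F) {c : Fin n}
    (hc : Function.update v l c ∈ C) (hcv : c ≠ v l) : subtorus (insert l F) v ⊆ C := by
  -- The parallel copy of the subtorus at height `c` fills one direction at a time: resetting
  -- coordinate `k` gives a neighbor in the part of the copy already filled, and resetting `l` gives
  -- a neighbor in the original subtorus.
  have key : ∀ G : Finset (Fin d), G ⊆ F → ∀ x ∈ subtorus G v, Function.update x l c ∈ C := by
    intro G
    induction G using Finset.induction_on with
    | empty =>
      intro _ x hx
      have : x = v := funext fun k => hx k (by simp)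
      rwa [this]
    | insert k G hk ih =>
      intro hG x hx
      have hkl : k ≠ l := fun h => hl (h ▸ hG (Finset.mem_insert_self k G))
      have h1 : Function.update (Function.update x k (v k)) l c ∈ C := by
        refine ih (fun j hj => hG (Finset.mem_insert_of_mem hj)) _ fun j hj => ?_
        by_cases hjk : j = k
        · simp [hjk]
        · simp only [Function.update_of_ne hjk]
          exact hx j (by simp [hjk, hj])
      have h2 : x ∈ C := hv fun j hj => hx j fun h => hj (hG h)
      refine mem_of_update_mem hC (k := k) (b := v k) (l := l) (c := x l) ?_ ?_ ?_
      · rwa [Function.update_comm hkl.symm]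
      · simpa using h2
      · intro h
        have h3 := congrFun h l
        simp only [Function.update_self, Function.update_of_ne hkl.symm] at h3
        have h4 : x l = v l := hx l fun h => hl (hG h)
        exact hcv (h3.trans h4)
  intro x hx
  have hx' : Function.update x l (v l) ∈ subtorus F v := by
    intro j hj
    by_cases hjl : j = l
    · simp [hjl]
    · simp only [Function.update_of_ne hjl]
      exact hx j (by simp [hjl, hj])
  refine mem_of_update_mem hC (hv hx') (l := l) (c := c) ?_ ?_
  · simpa using key F subset_rfl _ hx'
  · intro h
    have := congrFun h l
    simp only [Function.update_self] at this
    exact hcv this.symm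

/-- A closed set containing two subtori that share a node contains the subtorus that they
generate. -/
theorem Closed.subtorus_union_subset {C : Set (Node d n)} (hC : Closed C) {F : Finset (Fin d)}
    {v : Node d n} (hF : subtorus F v ⊆ C) (G : Finset (Fin d)) (hG : subtorus G v ⊆ C) :
    subtorus (F ∪ G) v ⊆ C := by
  induction G using Finset.induction_on with
  | empty => simpa using hF
  | insert l G hl ih =>
    have ih' := ih ((subtorus_subset_subtorus (Finset.subset_insert l G)
      (self_mem_subtorus _ v)).trans hG)
    rw [Finset.union_insert]
    by_cases hlF : l ∈ F ∪ G
    · rwa [Finset.insert_eq_of_mem hlF]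
    intro x hx
    by_cases hxl : x l = v l
    · refine ih' fun j hj => ?_
      by_cases hjl : j = l
      · rw [hjl, hxl]
      · exact hx j (by simp_all)
    · refine hC.subtorus_insert_subset ih' hlF (c := x l) (hG fun j hj => ?_) hxl hx
      rw [Function.update_of_ne]
      rintro rfl
      simp at hj

/-- A closed set containing two subtori at distance at most two contains the subtorus that they
generate. -/
theorem Closed.subtorus_subset_of_merge {C : Set (Node d n)} (hC : Closed C)
    {F₁ F₂ F : Finset (Fin d)} {v₁ v₂ v : Node d n} (h₁ : subtorus F₁ v₁ ⊆ C)
    (h₂ : subtorus F₂ v₂ ⊆ C) (hF₁ : F₁ ⊆ F) (hF₂ : F₂ ⊆ F) (hv₁ : v₁ ∈ subtorus F v)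
    (hv₂ : v₂ ∈ subtorus F v) (hF : ∀ l ∈ F, l ∈ F₁ ∨ l ∈ F₂ ∨ v₁ l ≠ v₂ l)
    (hcard : (F \ (F₁ ∪ F₂)).card ≤ 2) : subtorus F v ⊆ C := by
  -- `w₁` and `w₂` are nearest nodes of the two subtori; they differ exactly in the coordinates of
  -- `F \ (F₁ ∪ F₂)`.
  obtain ⟨w₁, hw₁⟩ : ∃ w : Node d n, w = fun l => if l ∈ F₁ then v₂ l else v₁ l := ⟨_, rfl⟩
  obtain ⟨w₂, hw₂⟩ : ∃ w : Node d n, w = fun l => if l ∈ F₂ then w₁ l else v₂ l := ⟨_, rfl⟩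
  have hm₁ : w₁ ∈ subtorus F₁ v₁ := fun l hl => by simp [hw₁, hl]
  have hm₂ : w₂ ∈ subtorus F₂ v₂ := fun l hl => by simp [hw₂, hl]
  have hwF : w₁ ∈ subtorus F v := fun l hl => by
    rw [hw₁]; dsimp only; rw [if_neg fun h => hl (hF₁ h), hv₁ l hl]
  have heq : ∀ l, l ∉ F \ (F₁ ∪ F₂) → w₂ l = w₁ l := by
    intro l hl
    rw [hw₂]
    by_cases h2 : l ∈ F₂
    · simp [h2]
    · by_cases h1 : l ∈ F₁
      · simp [h2, hw₁, h1]
      · have : l ∉ F := fun h => hl (by simp [h, h1, h2])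
        simp [h2, hw₁, h1, hv₁ l this, hv₂ l this]
  have hne : ∀ l, l ∈ F \ (F₁ ∪ F₂) → w₂ l ≠ w₁ l := by
    intro l hl
    simp only [Finset.mem_sdiff, Finset.mem_union, not_or] at hl
    have := hF l hl.1
    simp only [hl.2.1, hl.2.2, false_or] at this
    simpa [hw₂, hw₁, hl.2.1, hl.2.2] using this.symm
  have hC₁ : subtorus F₁ w₁ ⊆ C := by rwa [subtorus_eq hm₁]
  have hC₂ : subtorus F₂ w₂ ⊆ C := by rwa [subtorus_eq hm₂]
  have hFD : F = F₁ ∪ (F \ (F₁ ∪ F₂)) ∪ F₂ := by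
    ext l
    simp only [Finset.mem_union, Finset.mem_sdiff]
    have := @hF₁ l
    have := @hF₂ l
    tauto
  have hstep : subtorus (F₁ ∪ (F \ (F₁ ∪ F₂))) w₁ ⊆ C := by
    generalize hD : F \ (F₁ ∪ F₂) = D at heq hne hcard
    have hDF : ∀ l ∈ D, l ∉ F₁ := fun l hl => by
      rw [← hD] at hl
      simp at hl
      exact hl.2.1
    have hw₁C : w₁ ∈ C := hC₁ (self_mem_subtorus _ _)
    have hw₂C : w₂ ∈ C := hC₂ (self_mem_subtorus _ _)
    interval_cases hc : D.card
    · rw [Finset.card_eq_zero] at hc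
      simpa [hc] using hC₁
    · obtain ⟨l, rfl⟩ := Finset.card_eq_one.1 hc
      have hl := hDF l (by simp)
      have h2 : w₂ = Function.update w₁ l (w₂ l) := funext fun k => by
        by_cases hk : k = l
        · simp [hk]
        · rw [Function.update_of_ne hk]
          exact heq k (by simpa using hk)
      rw [Finset.union_comm, ← Finset.insert_eq]
      exact hC.subtorus_insert_subset hC₁ hl (h2 ▸ hw₂C) (hne l (by simp))
    · obtain ⟨k, l, hkl, rfl⟩ := Finset.card_eq_two.1 hc
      have hk := hDF k (by simp)
      have hl := hDF l (by simp)
      have h2 : w₂ = Function.update (Function.update w₁ k (w₂ k)) l (w₂ l) := funext fun j => by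
        by_cases hjl : j = l
        · simp [hjl]
        · rw [Function.update_of_ne hjl]
          by_cases hjk : j = k
          · simp [hjk]
          · rw [Function.update_of_ne hjk]
            exact heq j (by simp [hjl, hjk])
      -- At distance two, an intermediate node is adjacent to both nearest nodes, so it opens.
      have hmid : Function.update w₁ k (w₂ k) ∈ C := by
        refine mem_of_update_mem hC (k := l) (b := w₂ l) (l := k) (c := w₁ k) (h2 ▸ hw₂C)
          (by simpa using hw₁C) ?_
        rw [← h2]
        intro h
        have := congrFun h k
        simp only [Function.update_self] at this
        exact hne k (by simp) this
      have hk' := hC.subtorus_insert_subset hC₁ hk hmid (hne k (by simp))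
      have hin : Function.update w₁ k (w₂ k) ∈ subtorus (insert k F₁) w₁ := fun j hj => by
        rw [Function.update_of_ne]
        rintro rfl
        simp at hj
      rw [← subtorus_eq hin] at hk'
      have hl' : l ∉ insert k F₁ := by simp [hl, hkl.symm]
      have := hC.subtorus_insert_subset hk' hl' (h2 ▸ hw₂C)
        (by simpa [hkl.symm] using hne l (by simp))
      have hset : F₁ ∪ {k, l} = insert l (insert k F₁) := by
        ext j
        simp only [Finset.mem_union, Finset.mem_insert, Finset.mem_singleton]
        tauto
      have hin' := subtorus_eq (subtorus_subset_subtorus (Finset.subset_insert l _)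
        (self_mem_subtorus _ w₁) hin)
      rwa [hset, ← hin']
  have hw₂m : w₂ ∈ subtorus (F₁ ∪ (F \ (F₁ ∪ F₂))) w₁ := fun l hl =>
    heq l fun h => hl (Finset.mem_union_right _ h)
  rw [← subtorus_eq hw₂m] at hstep
  have := hC.subtorus_union_subset hstep F₂ hC₂
  rw [← hFD] at this
  rwa [← subtorus_eq hwF, ← subtorus_eq (show w₂ ∈ subtorus F w₁ from fun l hl =>
    heq l fun h => hl (Finset.mem_sdiff.1 h).1)]

end Deterministic

/-! ### Merge trees that witness spanning -/

section Witness

variable {d n : ℕ}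

/-- `Wit S F v`: the nodes of `S` span `subtorus F v` by successive merging of two subtori at
distance at most two, neither of them containing the other, which are generated by disjoint
sets. -/
inductive Wit : Finset (Node d n) → Finset (Fin d) → Node d n → Prop
  | single (v : Node d n) : Wit {v} ∅ v
  | merge {S₁ S₂ : Finset (Node d n)} {F₁ F₂ F : Finset (Fin d)} {v₁ v₂ v : Node d n}
      (h₁ : Wit S₁ F₁ v₁) (h₂ : Wit S₂ F₂ v₂) (hS : Disjoint S₁ S₂) (hF₁ : F₁ ⊂ F) (hF₂ : F₂ ⊂ F)
      (hv₁ : v₁ ∈ subtorus F v) (hv₂ : v₂ ∈ subtorus F v)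
      (hF : ∀ l ∈ F, l ∈ F₁ ∨ l ∈ F₂ ∨ v₁ l ≠ v₂ l) (hcard : (F \ (F₁ ∪ F₂)).card ≤ 2) :
      Wit (S₁ ∪ S₂) F v

theorem Wit.of_mem {S : Finset (Node d n)} {F : Finset (Fin d)} {v u : Node d n} (h : Wit S F v)
    (hu : u ∈ subtorus F v) : Wit S F u := by
  cases h with
  | single =>
    have : u = v := funext fun l => hu l (by simp)
    exact this ▸ Wit.single v
  | merge h₁ h₂ hS hF₁ hF₂ hv₁ hv₂ hF hcard =>
    exact Wit.merge h₁ h₂ hS hF₁ hF₂ (by rwa [subtorus_eq hu]) (by rwa [subtorus_eq hu]) hF hcard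

theorem Wit.subset_subtorus {S : Finset (Node d n)} {F : Finset (Fin d)} {v : Node d n}
    (h : Wit S F v) : (S : Set (Node d n)) ⊆ subtorus F v := by
  induction h with
  | single v => simpa using self_mem_subtorus _ v
  | merge h₁ h₂ hS hF₁ hF₂ hv₁ hv₂ hF hcard ih₁ ih₂ =>
    rw [Finset.coe_union]
    exact Set.union_subset (ih₁.trans (subtorus_subset_subtorus hF₁.subset hv₁))
      (ih₂.trans (subtorus_subset_subtorus hF₂.subset hv₂))

theorem Wit.subtorus_subset {S : Finset (Node d n)} {F : Finset (Fin d)} {v : Node d n}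
    (h : Wit S F v) {C : Set (Node d n)} (hC : Closed C) (hS : (S : Set (Node d n)) ⊆ C) :
    subtorus F v ⊆ C := by
  induction h with
  | single v =>
    intro x hx
    have : x = v := funext fun l => hx l (by simp)
    simpa [this] using hS
  | merge h₁ h₂ _ hF₁ hF₂ hv₁ hv₂ hF hcard ih₁ ih₂ =>
    rw [Finset.coe_union, Set.union_subset_iff] at hS
    exact hC.subtorus_subset_of_merge (ih₁ hS.1) (ih₂ hS.2) hF₁.subset hF₂.subset hv₁ hv₂ hF hcard

theorem Wit.internallySpans {S : Finset (Node d n)} {F : Finset (Fin d)} {v : Node d n}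
    (h : Wit S F v) {ω : Set (Node d n)} (hS : (S : Set (Node d n)) ⊆ ω) :
    InternallySpans ω (subtorus F v) :=
  (h.subtorus_subset (closed_span _)
    ((Set.subset_inter hS h.subset_subtorus).trans (subset_span _))).antisymm
    (span_subset (closed_subtorus F v) Set.inter_subset_right)

/-- The coordinates, free in neither of two subtori, in which these differ. -/
def gap (F : Finset (Fin d)) (u : Node d n) (G : Finset (Fin d)) (v : Node d n) :
    Finset (Fin d) :=
  Finset.univ.filter fun l => l ∉ F ∧ l ∉ G ∧ u l ≠ v l

theorem mem_gap {F G : Finset (Fin d)} {u v : Node d n} {l : Fin d} :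
    l ∈ gap F u G v ↔ l ∉ F ∧ l ∉ G ∧ u l ≠ v l := by simp [gap]

theorem gap_comm (F G : Finset (Fin d)) (u v : Node d n) : gap F u G v = gap G v F u := by
  ext l
  simp only [mem_gap]
  tauto

theorem card_gap_le_hammingDist {F G : Finset (Fin d)} {u v x y : Node d n}
    (hx : x ∈ subtorus F u) (hy : y ∈ subtorus G v) : (gap F u G v).card ≤ hammingDist x y := by
  refine Finset.card_le_card fun l hl => ?_
  rw [mem_gap] at hl
  simpa [hx l hl.1, hy l hl.2.1] using hl.2.2

theorem subtorus_subset_of_gap {F G : Finset (Fin d)} {u v : Node d n}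
    (h : F ∪ G ∪ gap F u G v = F) : subtorus G v ⊆ subtorus F u := by
  intro x hx l hl
  have hl' : l ∉ F ∪ G ∪ gap F u G v := by rwa [h]
  simp only [Finset.mem_union, mem_gap, not_or, not_and, not_not] at hl'
  rw [hx l hl'.1.2, hl'.2 hl'.1.1 hl'.1.2]

theorem Wit.merge_gap {S₁ S₂ : Finset (Node d n)} {F₁ F₂ : Finset (Fin d)} {v₁ v₂ : Node d n}
    (h₁ : Wit S₁ F₁ v₁) (h₂ : Wit S₂ F₂ v₂) (hS : Disjoint S₁ S₂)
    (hgap : (gap F₁ v₁ F₂ v₂).card ≤ 2) (hF₁ : F₁ ∪ F₂ ∪ gap F₁ v₁ F₂ v₂ ≠ F₁)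
    (hF₂ : F₁ ∪ F₂ ∪ gap F₁ v₁ F₂ v₂ ≠ F₂) :
    Wit (S₁ ∪ S₂) (F₁ ∪ F₂ ∪ gap F₁ v₁ F₂ v₂) v₁ := by
  refine Wit.merge h₁ h₂ hS (Finset.ssubset_iff_subset_ne.2 ⟨fun l hl => by simp [hl], hF₁.symm⟩)
    (Finset.ssubset_iff_subset_ne.2 ⟨fun l hl => by simp [hl], hF₂.symm⟩)
    (self_mem_subtorus _ _) ?_ ?_ ?_
  · intro l hl
    simp only [Finset.mem_union, mem_gap, not_or, not_and, not_not] at hl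
    exact (hl.2 hl.1.1 hl.1.2).symm
  · intro l hl
    simp only [Finset.mem_union, mem_gap] at hl
    tauto
  · refine (Finset.card_le_card fun l hl => ?_).trans hgap
    simp only [Finset.mem_union, Finset.mem_sdiff] at hl
    tauto

/-- A family of disjoint subsets of `ω`, generating subtori that cover `ω`. -/
structure IsWitFamily (ω : Set (Node d n))
    (𝒞 : Finset (Finset (Node d n) × Finset (Fin d) × Node d n)) : Prop where
  wit : ∀ T ∈ 𝒞, Wit T.1 T.2.1 T.2.2
  subset : ∀ T ∈ 𝒞, (T.1 : Set (Node d n)) ⊆ ω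
  disjoint : ∀ T ∈ 𝒞, ∀ T' ∈ 𝒞, T ≠ T' → Disjoint T.1 T'.1
  cover : ∀ x ∈ ω, ∃ T ∈ 𝒞, x ∈ subtorus T.2.1 T.2.2

theorem exists_isWitFamily (ω : Set (Node d n)) : ∃ 𝒞, IsWitFamily ω 𝒞 := by
  classical
  refine ⟨(Finset.univ.filter (· ∈ ω)).image fun v => ({v}, ∅, v), ?_, ?_, ?_, ?_⟩
  · intro T hT
    obtain ⟨v, -, rfl⟩ := Finset.mem_image.1 hT
    exact Wit.single v
  · intro T hT
    obtain ⟨v, hv, rfl⟩ := Finset.mem_image.1 hT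
    simpa using hv
  · intro T hT T' hT' hne
    obtain ⟨v, -, rfl⟩ := Finset.mem_image.1 hT
    obtain ⟨w, -, rfl⟩ := Finset.mem_image.1 hT'
    rw [Finset.disjoint_singleton]
    rintro rfl
    exact hne rfl
  · intro x hx
    exact ⟨({x}, ∅, x), Finset.mem_image.2 ⟨x, by simpa using hx, rfl⟩, self_mem_subtorus _ x⟩

/-- Two close members either merge into one, or one subtorus contains the other and the smaller is
dropped. Discarding in the second case is what keeps the inclusions in `Wit.merge` strict. -/
theorem IsWitFamily.exists_card_lt {ω : Set (Node d n)}
    {𝒞 : Finset (Finset (Node d n) × Finset (Fin d) × Node d n)} (h : IsWitFamily ω 𝒞)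
    {T T' : Finset (Node d n) × Finset (Fin d) × Node d n} (hT : T ∈ 𝒞) (hT' : T' ∈ 𝒞)
    (hne : T ≠ T') (hgap : (gap T.2.1 T.2.2 T'.2.1 T'.2.2).card ≤ 2) :
    ∃ 𝒞', IsWitFamily ω 𝒞' ∧ 𝒞'.card < 𝒞.card := by
  classical
  have hdrop : ∀ {T T' : Finset (Node d n) × Finset (Fin d) × Node d n}, T ∈ 𝒞 → T' ∈ 𝒞 →
      T ≠ T' → subtorus T'.2.1 T'.2.2 ⊆ subtorus T.2.1 T.2.2 →
      ∃ 𝒞', IsWitFamily ω 𝒞' ∧ 𝒞'.card < 𝒞.card := by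
    intro T T' hT hT' hne hsub
    refine ⟨𝒞.erase T', ⟨fun U hU => h.wit U (Finset.mem_of_mem_erase hU),
      fun U hU => h.subset U (Finset.mem_of_mem_erase hU),
      fun U hU U' hU' => h.disjoint U (Finset.mem_of_mem_erase hU) U'
        (Finset.mem_of_mem_erase hU'), fun x hx => ?_⟩, Finset.card_erase_lt_of_mem hT'⟩
    obtain ⟨U, hU, hxU⟩ := h.cover x hx
    by_cases hUT : U = T'
    · exact ⟨T, Finset.mem_erase.2 ⟨hne, hT⟩, hsub (hUT ▸ hxU)⟩
    · exact ⟨U, Finset.mem_erase.2 ⟨hUT, hU⟩, hxU⟩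
  by_cases h₁ : T.2.1 ∪ T'.2.1 ∪ gap T.2.1 T.2.2 T'.2.1 T'.2.2 = T.2.1
  · exact hdrop hT hT' hne (subtorus_subset_of_gap h₁)
  by_cases h₂ : T.2.1 ∪ T'.2.1 ∪ gap T.2.1 T.2.2 T'.2.1 T'.2.2 = T'.2.1
  · refine hdrop hT' hT hne.symm (subtorus_subset_of_gap ?_)
    rwa [gap_comm, Finset.union_comm T'.2.1]
  have hW := (h.wit T hT).merge_gap (h.wit T' hT') (h.disjoint T hT T' hT' hne) hgap h₁ h₂
  generalize hG : T.2.1 ∪ T'.2.1 ∪ gap T.2.1 T.2.2 T'.2.1 T'.2.2 = G at hW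
  have hTG : subtorus T.2.1 T.2.2 ⊆ subtorus G T.2.2 :=
    subtorus_subset_subtorus (fun l hl => by simp [← hG, hl]) (self_mem_subtorus _ _)
  have hTG' : subtorus T'.2.1 T'.2.2 ⊆ subtorus G T.2.2 := by
    refine subtorus_subset_subtorus (fun l hl => by simp [← hG, hl]) fun l hl => ?_
    simp only [← hG, Finset.mem_union, mem_gap, not_or, not_and, not_not] at hl
    exact (hl.2 hl.1.1 hl.1.2).symm
  have hmem : ∀ {U}, U ∈ (𝒞.erase T).erase T' → U ∈ 𝒞 ∧ U ≠ T ∧ U ≠ T' := by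
    intro U hU
    simp only [Finset.mem_erase] at hU
    exact ⟨hU.2.2, hU.2.1, hU.1⟩
  have hdisj : ∀ U ∈ (𝒞.erase T).erase T', Disjoint (T.1 ∪ T'.1) U.1 := fun U hU =>
    Finset.disjoint_union_left.2 ⟨h.disjoint T hT U (hmem hU).1 (hmem hU).2.1.symm,
      h.disjoint T' hT' U (hmem hU).1 (hmem hU).2.2.symm⟩
  refine ⟨insert (T.1 ∪ T'.1, G, T.2.2) ((𝒞.erase T).erase T'), ⟨?_, ?_, ?_, ?_⟩, ?_⟩
  · intro U hU
    rcases Finset.mem_insert.1 hU with rfl | hU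
    · exact hW
    · exact h.wit U (hmem hU).1
  · intro U hU
    rcases Finset.mem_insert.1 hU with rfl | hU
    · simpa using ⟨h.subset T hT, h.subset T' hT'⟩
    · exact h.subset U (hmem hU).1
  · intro U hU U' hU' hne'
    rcases Finset.mem_insert.1 hU with rfl | hU
    · rcases Finset.mem_insert.1 hU' with rfl | hU'
      · exact absurd rfl hne'
      · exact hdisj U' hU'
    · rcases Finset.mem_insert.1 hU' with rfl | hU'
      · exact (hdisj U hU).symm
      · exact h.disjoint U (hmem hU).1 U' (hmem hU').1 hne'
  · intro x hx
    obtain ⟨U, hU, hxU⟩ := h.cover x hx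
    by_cases hUT : U = T
    · exact ⟨_, Finset.mem_insert_self _ _, hTG (hUT ▸ hxU)⟩
    by_cases hUT' : U = T'
    · exact ⟨_, Finset.mem_insert_self _ _, hTG' (hUT' ▸ hxU)⟩
    · exact ⟨U, Finset.mem_insert_of_mem (by simp [hUT, hUT', hU]), hxU⟩
  · have hT'' : T' ∈ 𝒞.erase T := Finset.mem_erase.2 ⟨hne.symm, hT'⟩
    have h1 := Finset.card_erase_lt_of_mem hT''
    have h2 := Finset.card_erase_lt_of_mem hT
    have h3 := Finset.card_insert_le (T.1 ∪ T'.1, G, T.2.2) ((𝒞.erase T).erase T')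
    omega

/-- If the span of `ω` is everything then some subset of `ω` generates the whole torus by
merging. -/
theorem exists_wit_univ (hn : 2 ≤ n) {ω : Set (Node d n)} (h : span ω = Set.univ) :
    ∃ (S : Finset (Node d n)) (v : Node d n), Wit S Finset.univ v ∧ (S : Set (Node d n)) ⊆ ω := by
  classical
  -- In a family of minimal size the subtori are pairwise at distance greater than two, since
  -- otherwise `IsWitFamily.exists_card_lt` would shrink it.
  obtain ⟨𝒞, h𝒞, hmin⟩ := WellFounded.has_min (measure Finset.card).wf
    {𝒞 | IsWitFamily ω 𝒞} (exists_isWitFamily ω)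
  have hfar : ∀ T ∈ 𝒞, ∀ T' ∈ 𝒞, T ≠ T' → 2 < (gap T.2.1 T.2.2 T'.2.1 T'.2.2).card := by
    intro T hT T' hT' hne
    by_contra hle
    obtain ⟨𝒞', h1, h2⟩ := IsWitFamily.exists_card_lt h𝒞 hT hT' hne (not_lt.1 hle)
    exact hmin 𝒞' h1 h2
  have hsame : ∀ T ∈ 𝒞, ∀ T' ∈ 𝒞, ∀ x ∈ subtorus T.2.1 T.2.2, ∀ y ∈ subtorus T'.2.1 T'.2.2,
      hammingDist x y ≤ 2 → T = T' := by
    intro T hT T' hT' x hx y hy hxy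
    by_contra hne
    have h1 := hfar T hT T' hT' hne
    have h2 := card_gap_le_hammingDist hx hy
    omega
  -- Two neighbors of one node are within distance two of each other, hence lie in the same member,
  -- which is itself closed.
  have hclosed : Closed (⋃ T ∈ 𝒞, subtorus T.2.1 T.2.2) := by
    intro x u w hu hw huw hxu hxw
    simp only [Set.mem_iUnion, exists_prop] at hu hw ⊢
    obtain ⟨T, hT, hu⟩ := hu
    obtain ⟨T', hT', hw⟩ := hw
    have htri := hammingDist_triangle u x w
    rw [hammingDist_comm u x] at htri
    obtain rfl := hsame T hT T' hT' u hu w hw (by omega)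
    exact ⟨T, hT, closed_subtorus _ _ x u w hu hw huw hxu hxw⟩
  have huniv : ∀ x : Node d n, ∃ T ∈ 𝒞, x ∈ subtorus T.2.1 T.2.2 := by
    intro x
    have hx : x ∈ span ω := h ▸ Set.mem_univ x
    have := span_subset hclosed (fun y hy => by
      obtain ⟨T, hT, hyT⟩ := h𝒞.cover y hy
      exact Set.mem_biUnion hT hyT) hx
    simpa using this
  obtain ⟨T, hT, hx⟩ := huniv fun _ => ⟨0, by omega⟩
  refine ⟨T.1, T.2.2, ?_, h𝒞.subset T hT⟩
  -- The members cover the torus, so a step out of one member in a direction not free in it would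
  -- land in a second member at distance one.
  have hTuniv : T.2.1 = Finset.univ := by
    by_contra hne
    obtain ⟨l, hl⟩ : ∃ l, l ∉ T.2.1 := by
      by_contra hall
      push Not at hall
      exact hne (Finset.eq_univ_iff_forall.2 hall)
    obtain ⟨T', hT', hy⟩ := huniv (Function.update (fun _ => ⟨0, by omega⟩) l ⟨1, by omega⟩)
    obtain rfl := hsame T hT T' hT' _ hx _ hy ((hammingDist_update_le _ _ _).trans one_le_two)
    have h1 := hx l hl
    have h2 := hy l hl
    rw [← h1, Function.update_self] at h2
    simp at h2
  exact hTuniv ▸ h𝒞.wit T hT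

/-- `S` generates `subtorus F v` by merging two subtori of dimensions at most `m`. -/
def WitMerge (m : ℕ) (S : Finset (Node d n)) (F : Finset (Fin d)) (v : Node d n) : Prop :=
  ∃ (S₁ S₂ : Finset (Node d n)) (F₁ F₂ : Finset (Fin d)) (v₁ v₂ : Node d n),
    S = S₁ ∪ S₂ ∧ Disjoint S₁ S₂ ∧ Wit S₁ F₁ v₁ ∧ Wit S₂ F₂ v₂ ∧ F₁ ⊂ F ∧ F₂ ⊂ F ∧
    F.card ≤ F₁.card + F₂.card + 2 ∧ F₁.card ≤ m ∧ F₂.card ≤ m ∧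
    v₁ ∈ subtorus F v ∧ v₂ ∈ subtorus F v

theorem card_le_of_merge {F₁ F₂ F : Finset (Fin d)} (hcard : (F \ (F₁ ∪ F₂)).card ≤ 2) :
    F.card ≤ F₁.card + F₂.card + 2 := by
  have h1 := Finset.card_le_card_sdiff_add_card (s := F) (t := F₁ ∪ F₂)
  have h2 := Finset.card_union_le F₁ F₂
  omega

theorem Wit.eq_or_witMerge {S : Finset (Node d n)} {F : Finset (Fin d)} {v : Node d n}
    (h : Wit S F v) : F = ∅ ∧ S = {v} ∨ WitMerge (F.card - 1) S F v := by
  cases h with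
  | single => exact Or.inl ⟨rfl, rfl⟩
  | merge h₁ h₂ hS hF₁ hF₂ hv₁ hv₂ hF hcard =>
    exact Or.inr ⟨_, _, _, _, _, _, rfl, hS, h₁, h₂, hF₁, hF₂, card_le_of_merge hcard,
      Nat.le_sub_one_of_lt (Finset.card_lt_card hF₁), Nat.le_sub_one_of_lt (Finset.card_lt_card hF₂),
      hv₁, hv₂⟩

/-- Generating a subtorus of dimension more than `m` involves generating one of dimension
`m + 1` or `m + 2`, or merging two of dimension at most `m` to one of dimension at least `m + 3`. -/
theorem Wit.exists_sub {S : Finset (Node d n)} {F : Finset (Fin d)} {v : Node d n}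
    (h : Wit S F v) {m : ℕ} (hm : m < F.card) :
    ∃ S' F' v', S' ⊆ S ∧ Wit S' F' v' ∧
      (F'.card = m + 1 ∨ F'.card = m + 2 ∨ m + 3 ≤ F'.card ∧ WitMerge m S' F' v') := by
  induction h with
  | single => simp at hm
  | @merge S₁ S₂ F₁ F₂ F v₁ v₂ v h₁ h₂ hS hF₁ hF₂ hv₁ hv₂ hF hcard ih₁ ih₂ =>
    -- Descend into a child of dimension above `m` as long as there is one; at the stopping point
    -- both children have dimension at most `m`.
    by_cases hm₁ : m < F₁.card
    · obtain ⟨S', F', v', hS', h'⟩ := ih₁ hm₁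
      exact ⟨S', F', v', hS'.trans Finset.subset_union_left, h'⟩
    by_cases hm₂ : m < F₂.card
    · obtain ⟨S', F', v', hS', h'⟩ := ih₂ hm₂
      exact ⟨S', F', v', hS'.trans Finset.subset_union_right, h'⟩
    refine ⟨S₁ ∪ S₂, F, v, subset_rfl, Wit.merge h₁ h₂ hS hF₁ hF₂ hv₁ hv₂ hF hcard, ?_⟩
    by_cases h1 : F.card = m + 1
    · exact Or.inl h1
    by_cases h2 : F.card = m + 2
    · exact Or.inr (Or.inl h2)
    exact Or.inr (Or.inr ⟨by omega, _, _, _, _, _, _, rfl, hS, h₁, h₂, hF₁, hF₂,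
      card_le_of_merge hcard, not_lt.1 hm₁, not_lt.1 hm₂, hv₁, hv₂⟩)

/-- If the whole torus is internally spanned then so is a subtorus of dimension `m + 2`, unless
one of dimension `m + 1` is generated or two of dimension at most `m` merge to one of dimension
at least `m + 3`. -/
theorem exists_wit_of_mem_spannedEvent (hn : 2 ≤ n) {m : ℕ} (hm : m < d) {ω : Set (Node d n)}
    (h : ω ∈ spannedEvent d n d \ spannedEvent d n (m + 2)) :
    ∃ (S : Finset (Node d n)) (F : Finset (Fin d)) (v : Node d n), (S : Set (Node d n)) ⊆ ω ∧
      (F.card = m + 1 ∧ Wit S F v ∨ m + 3 ≤ F.card ∧ WitMerge m S F v) := by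
  obtain ⟨⟨V, hV, hspan⟩, hnot⟩ := h
  obtain ⟨F, v, hF, rfl⟩ := hV.exists_eq
  have hFu : F = Finset.univ := Finset.eq_univ_of_card F (by simp [hF])
  have huniv : subtorus F v = Set.univ := by
    rw [hFu]
    exact Set.eq_univ_of_forall fun x l hl => absurd (Finset.mem_univ l) hl
  rw [InternallySpans, huniv, Set.inter_univ] at hspan
  obtain ⟨S, w, hW, hS⟩ := exists_wit_univ hn hspan.symm
  obtain ⟨S', F', v', hS', hW', h1 | h2 | h3⟩ := hW.exists_sub (m := m) (by simpa using hm)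
  · exact ⟨S', F', v', (Finset.coe_subset.2 hS').trans hS, Or.inl ⟨h1, hW'⟩⟩
  · exact absurd ⟨_, h2 ▸ isSubtorus_subtorus F' v',
      hW'.internallySpans ((Finset.coe_subset.2 hS').trans hS)⟩ hnot
  · exact ⟨S', F', v', (Finset.coe_subset.2 hS').trans hS, Or.inr h3⟩

end Witness

/-! ### Product measure: union bound, Harris' inequality, planting a finite set -/

section Bernoulli

theorem setBernoulli_real_superset {V : Type*} (p : unitInterval) (S : Finset V) :
    (setBernoulli Set.univ p).real {ω : Set V | (S : Set V) ⊆ ω} = (p : ℝ) ^ S.card := by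
  have h : setBernoulli Set.univ p {ω : Set V | (S : Set V) ⊆ ω} =
      (unitInterval.toNNReal p : ENNReal) ^ S.card := by
    rw [setBernoulli_apply']
    have : (fun p : V → Prop => {i | p i}) ⁻¹' {ω : Set V | (S : Set V) ⊆ ω} =
        Set.pi (S : Set V) fun _ => {True} := by
      ext x
      simp [Set.subset_def, Set.mem_pi]
    rw [this, Measure.infinitePi_pi _ (by simp)]
    simp
  rw [measureReal_def, h]
  simp

theorem setBernoulli_real_exists_superset_le {V : Type*} {p : unitInterval} (𝒮 : Finset (Finset V)) :
    (setBernoulli Set.univ p).real {ω : Set V | ∃ S ∈ 𝒮, (S : Set V) ⊆ ω} ≤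
      ∑ S ∈ 𝒮, (p : ℝ) ^ S.card := by
  have : {ω : Set V | ∃ S ∈ 𝒮, (S : Set V) ⊆ ω} = ⋃ S ∈ 𝒮, {ω : Set V | (S : Set V) ⊆ ω} := by
    ext ω
    simp
  rw [this]
  refine (measureReal_biUnion_finset_le _ _).trans_eq ?_
  simp_rw [setBernoulli_real_superset]

variable {V : Type*} [Finite V]

theorem setBernoulli_real_eq_sum (p : unitInterval) (𝒜 : Finset (Set V)) :
    (setBernoulli Set.univ p).real (𝒜 : Set (Set V)) =
      ∑ ω ∈ 𝒜, (p : ℝ) ^ ω.ncard * (1 - p : ℝ) ^ ωᶜ.ncard := by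
  rw [← sum_measureReal_singleton]
  refine Finset.sum_congr rfl fun ω _ => ?_
  rw [setBernoulli_real_singleton p (Set.subset_univ ω) Set.finite_univ, Set.compl_eq_univ_sdiff]

/-- Harris' inequality: decreasing events are positively correlated. -/
theorem setBernoulli_real_mul_le (p : unitInterval) {𝒜 ℬ : Set (Set V)} (h𝒜 : IsLowerSet 𝒜)
    (hℬ : IsLowerSet ℬ) :
    (setBernoulli Set.univ p).real 𝒜 * (setBernoulli Set.univ p).real ℬ ≤
      (setBernoulli Set.univ p).real (𝒜 ∩ ℬ) := by
  classical
  have := Fintype.ofFinite V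
  have hreal : ∀ 𝒞 : Set (Set V), (setBernoulli Set.univ p).real 𝒞 =
      ∑ ω : (Set V)ᵒᵈ, ((p : ℝ) ^ (OrderDual.ofDual ω).ncard *
        (1 - p : ℝ) ^ (OrderDual.ofDual ω)ᶜ.ncard) *
        if OrderDual.ofDual ω ∈ 𝒞 then 1 else 0 := by
    intro 𝒞
    have h1 := setBernoulli_real_eq_sum p (Finset.univ.filter (· ∈ 𝒞))
    rw [Finset.coe_filter] at h1
    simp only [Finset.mem_univ, true_and, Set.ofPred_mem_eq] at h1
    rw [h1, Finset.sum_filter]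
    exact Finset.sum_congr rfl fun ω _ => by
      rw [mul_ite, mul_one, mul_zero]
      rfl
  have hp0 : (0 : ℝ) ≤ p := p.2.1
  have hp1 : (0 : ℝ) ≤ 1 - p := sub_nonneg.2 p.2.2
  have hmono : ∀ {𝒞 : Set (Set V)}, IsLowerSet 𝒞 → Monotone
      fun ω : (Set V)ᵒᵈ => if OrderDual.ofDual ω ∈ 𝒞 then (1 : ℝ) else 0 := by
    intro 𝒞 h𝒞 ω ω' hω
    dsimp only
    by_cases h1 : OrderDual.ofDual ω ∈ 𝒞
    · have h2 : OrderDual.ofDual ω' ∈ 𝒞 := h𝒞 hω h1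
      rw [if_pos h1, if_pos h2]
    · rw [if_neg h1]
      split_ifs <;> norm_num
  have hcard : ∀ a b : Set V, (a ∩ b).ncard + (a ∪ b).ncard = a.ncard + b.ncard := fun a b => by
    rw [add_comm, Set.ncard_union_add_ncard_inter]
  -- Decreasing events become increasing in the order dual. The lattice condition on the weight
  -- holds with equality, since cardinality is modular.
  have hfkg := fkg (fun ω : (Set V)ᵒᵈ => if OrderDual.ofDual ω ∈ 𝒜 then (1 : ℝ) else 0)
    (fun ω : (Set V)ᵒᵈ => if OrderDual.ofDual ω ∈ ℬ then (1 : ℝ) else 0)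
    (fun ω : (Set V)ᵒᵈ => (p : ℝ) ^ (OrderDual.ofDual ω).ncard *
      (1 - p : ℝ) ^ (OrderDual.ofDual ω)ᶜ.ncard)
    (fun ω => by simp only [Pi.zero_apply]; positivity)
    (fun ω => by simp only [Pi.zero_apply]; positivity)
    (fun ω => by simp only [Pi.zero_apply]; positivity) (hmono h𝒜) (hmono hℬ) (fun a b => by
      simp only [ofDual_inf, ofDual_sup, Set.sup_eq_union, Set.inf_eq_inter, Set.compl_union,
        Set.compl_inter]
      refine le_of_eq ?_
      rw [mul_mul_mul_comm, ← pow_add, ← pow_add, mul_mul_mul_comm, ← pow_add, ← pow_add,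
        add_comm (Set.ncard (_ ∪ _)), hcard, hcard])
  have hone := hreal Set.univ
  rw [probReal_univ] at hone
  simp only [Set.mem_univ, if_true, mul_one] at hone
  rw [← hone, one_mul, ← hreal, ← hreal] at hfkg
  refine hfkg.trans_eq ?_
  rw [hreal]
  refine Finset.sum_congr rfl fun ω _ => ?_
  by_cases h1 : OrderDual.ofDual ω ∈ 𝒜 <;> by_cases h2 : OrderDual.ofDual ω ∈ ℬ <;> simp [h1, h2]

/-- Lower bound for the probability of containing no member of a family of sets of size `k`. -/
theorem one_sub_pow_le_setBernoulli_real (p : unitInterval) (k : ℕ) (𝒮 : Finset (Finset V))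
    (h𝒮 : ∀ S ∈ 𝒮, S.card = k) :
    (1 - (p : ℝ) ^ k) ^ 𝒮.card ≤
      (setBernoulli Set.univ p).real {ω : Set V | ∀ S ∈ 𝒮, ¬ (S : Set V) ⊆ ω} := by
  classical
  induction 𝒮 using Finset.induction_on with
  | empty => simp
  | insert S 𝒮 hS ih =>
    have h1 : {ω : Set V | ∀ T ∈ insert S 𝒮, ¬ (T : Set V) ⊆ ω} =
        {ω : Set V | ¬ (S : Set V) ⊆ ω} ∩ {ω : Set V | ∀ T ∈ 𝒮, ¬ (T : Set V) ⊆ ω} := by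
      ext ω
      simp
    have hlow : IsLowerSet {ω : Set V | ∀ T ∈ 𝒮, ¬ (T : Set V) ⊆ ω} :=
      fun _ _ hle h T hT h' => h T hT (h'.trans hle)
    have h2 : (setBernoulli Set.univ p).real {ω : Set V | ¬ (S : Set V) ⊆ ω} =
        1 - (p : ℝ) ^ k := by
      have h3 : {ω : Set V | ¬ (S : Set V) ⊆ ω} = {ω : Set V | (S : Set V) ⊆ ω}ᶜ := rfl
      rw [h3, probReal_compl_eq_one_sub (Set.toFinite _).measurableSet,
        setBernoulli_real_superset, h𝒮 S (by simp)]
    rw [Finset.card_insert_of_notMem hS, pow_succ', h1]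
    refine le_trans ?_ (setBernoulli_real_mul_le p (fun _ _ hle h h' => h (h'.trans hle)) hlow)
    rw [h2]
    refine mul_le_mul_of_nonneg_left (ih fun T hT => h𝒮 T (Finset.mem_insert_of_mem hT)) ?_
    exact sub_nonneg.2 (pow_le_one₀ p.2.1 p.2.2)

/-- Adding a fixed set of `k` nodes to the configurations of an event costs at most a
factor `p ^ k`. -/
theorem pow_mul_setBernoulli_real_le (p : unitInterval) (A : Finset V) {𝒟 : Set (Set V)}
    (h𝒟 : ∀ ω ∈ 𝒟, Disjoint (A : Set V) ω) :
    (p : ℝ) ^ A.card * (setBernoulli Set.univ p).real 𝒟 ≤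
      (setBernoulli Set.univ p).real ((fun ω => (A : Set V) ∪ ω) '' 𝒟) := by
  classical
  have hp0 : (0 : ℝ) ≤ p := p.2.1
  have hp1 : (0 : ℝ) ≤ 1 - p := sub_nonneg.2 p.2.2
  obtain ⟨D, rfl⟩ := (Set.toFinite 𝒟).exists_finset_coe
  have hinj : Set.InjOn (fun ω => (A : Set V) ∪ ω) (D : Set (Set V)) := by
    intro ω hω ω' hω' h
    have h1 : ((A : Set V) ∪ ω) \ A = ((A : Set V) ∪ ω') \ A := by
      simp only at h
      rw [h]
    rwa [Set.union_sdiff_cancel_left, Set.union_sdiff_cancel_left] at h1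
    · exact (h𝒟 ω' hω').inter_eq.subset
    · exact (h𝒟 ω hω).inter_eq.subset
  rw [← Finset.coe_image, setBernoulli_real_eq_sum, setBernoulli_real_eq_sum,
    Finset.sum_image hinj, Finset.mul_sum]
  refine Finset.sum_le_sum fun ω hω => ?_
  -- Planting `A` contributes the factor `p ^ A.card` and shrinks the complement, so the power of `1
  -- - p` does not decrease.
  rw [Set.ncard_union_eq (h𝒟 ω hω), Set.ncard_coe_finset, pow_add, mul_assoc]
  refine mul_le_mul_of_nonneg_left (mul_le_mul_of_nonneg_left ?_ (by positivity)) (by positivity)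
  exact pow_le_pow_of_le_one hp1 (sub_le_self _ hp0)
    (Set.ncard_le_ncard (Set.compl_subset_compl.2 Set.subset_union_right))

end Bernoulli

/-! ### First moment bounds -/

section Weight

variable {d n : ℕ}

/-- The nodes of `subtorus F v`. -/
def subtorusFinset (F : Finset (Fin d)) (v : Node d n) : Finset (Node d n) :=
  Fintype.piFinset fun l => if l ∈ F then Finset.univ else {v l}

theorem mem_subtorusFinset {F : Finset (Fin d)} {u v : Node d n} :
    u ∈ subtorusFinset F v ↔ u ∈ subtorus F v := by
  rw [subtorusFinset, Fintype.mem_piFinset]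
  refine forall_congr' fun l => ?_
  by_cases h : l ∈ F <;> simp [h]

theorem card_subtorusFinset (F : Finset (Fin d)) (v : Node d n) :
    (subtorusFinset F v).card = n ^ F.card := by
  rw [subtorusFinset, Fintype.card_piFinset, ← Finset.prod_subset F.subset_univ,
    Finset.prod_congr rfl (g := fun _ => n), Finset.prod_const]
  · intro l hl
    simp [hl]
  · intro l _ hl
    simp [hl]

/-- Normalizes base nodes: every subtorus with free coordinates `G` that meets `subtorus F v` is
represented by a node varying only in `F \ G`. For `G ⊆ F` this leaves `n ^ (F.card - G.card)`
positions. -/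
theorem exists_mem_subtorusFinset_sdiff {F G : Finset (Fin d)} {u v : Node d n}
    (hu : u ∈ subtorus F v) : ∃ w ∈ subtorusFinset (F \ G) v, w ∈ subtorus G u := by
  refine ⟨fun l => if l ∈ G then v l else u l, mem_subtorusFinset.2 fun l hl => ?_,
    fun l hl => by simp [hl]⟩
  by_cases h : l ∈ G
  · simp [h]
  · have : l ∉ F := fun h' => hl (by simp [h, h'])
    simp [h, hu l this]

open Classical in
/-- The sum of `p ^ S.card` over the sets `S` that generate `subtorus F v`. -/
noncomputable def weight (p : ℝ) (F : Finset (Fin d)) (v : Node d n) : ℝ :=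
  ∑ S ∈ Finset.univ.filter (Wit · F v), p ^ S.card

open Classical in
/-- The sum of `p ^ S.card` over the sets `S` that generate `subtorus F v` by merging two subtori
of dimensions at most `m`. -/
noncomputable def mergeWeight (p : ℝ) (m : ℕ) (F : Finset (Fin d)) (v : Node d n) : ℝ :=
  ∑ S ∈ Finset.univ.filter (WitMerge m · F v), p ^ S.card

theorem weight_empty_le {p : ℝ} (hp : 0 ≤ p) (v : Node d n) : weight p ∅ v ≤ p := by
  classical
  rw [weight]
  calc _ ≤ ∑ S ∈ ({{v}} : Finset (Finset (Node d n))), p ^ S.card := by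
        refine Finset.sum_le_sum_of_subset_of_nonneg (fun S hS => ?_) fun _ _ _ => pow_nonneg hp _
        rcases (Finset.mem_filter.1 hS).2.eq_or_witMerge with ⟨-, rfl⟩ | h
        · simp
        · obtain ⟨_, _, F₁, _, _, _, _, _, _, _, h, _⟩ := h
          exact absurd h (Finset.not_ssubset_empty F₁)
    _ = p := by simp

theorem weight_le_mergeWeight {p : ℝ} (hp : 0 ≤ p) {F : Finset (Fin d)} (hF : F ≠ ∅)
    (v : Node d n) : weight p F v ≤ mergeWeight p (F.card - 1) F v := by
  classical
  refine Finset.sum_le_sum_of_subset_of_nonneg (fun S hS => ?_) fun _ _ _ => pow_nonneg hp _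
  rw [Finset.mem_filter] at hS ⊢
  exact ⟨hS.1, hS.2.eq_or_witMerge.resolve_left fun h => hF h.1⟩

/-- A union bound over the last merge: at most `4 ^ d` pairs of direction sets, then the positions
of the two subtori, then their generating sets. Since these are disjoint, `p ^ S.card` factors, and
`X` dominates the resulting product. -/
theorem mergeWeight_le {p : ℝ} (hp : 0 ≤ p) (m : ℕ) (F : Finset (Fin d)) (v : Node d n)
    (B : ℕ → ℝ) (hB : ∀ (G : Finset (Fin d)) (u : Node d n), G.card ≤ m →
      weight p G u ≤ B G.card) (X : ℝ) (hX0 : 0 ≤ X)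
    (hX : ∀ i₁ i₂, i₁ ≤ m → i₂ ≤ m → i₁ < F.card → i₂ < F.card → F.card ≤ i₁ + i₂ + 2 →
      ((n : ℝ) ^ (F.card - i₁) * B i₁) * ((n : ℝ) ^ (F.card - i₂) * B i₂) ≤ X) :
    mergeWeight p m F v ≤ 4 ^ d * X := by
  classical
  let U : Finset (Fin d) → Finset (Σ _ : Node d n, Finset (Node d n)) := fun G =>
    (subtorusFinset (F \ G) v).sigma fun u => Finset.univ.filter (Wit · G u)
  let P : Finset (Finset (Fin d) × Finset (Fin d)) := Finset.univ.filter fun q =>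
    q.1 ⊂ F ∧ q.2 ⊂ F ∧ F.card ≤ q.1.card + q.2.card + 2 ∧ q.1.card ≤ m ∧ q.2.card ≤ m
  let I := (P.sigma fun q => U q.1 ×ˢ U q.2).filter fun x => Disjoint x.2.1.2 x.2.2.2
  have hU : ∀ G ⊆ F, G.card ≤ m → ∑ x ∈ U G, p ^ x.2.card ≤
      (n : ℝ) ^ (F.card - G.card) * B G.card := by
    intro G hG hm
    rw [Finset.sum_sigma, ← Finset.card_sdiff_of_subset hG, ← Nat.cast_pow,
      ← card_subtorusFinset (F \ G) v, ← nsmul_eq_mul]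
    exact Finset.sum_le_card_nsmul _ _ _ fun u _ => hB G u hm
  have hsub : Finset.univ.filter (WitMerge m · F v) ⊆ I.image fun x => x.2.1.2 ∪ x.2.2.2 := by
    intro S hS
    obtain ⟨S₁, S₂, F₁, F₂, v₁, v₂, rfl, hS, h₁, h₂, hF₁, hF₂, hcard, hm₁, hm₂, hv₁, hv₂⟩ :=
      (Finset.mem_filter.1 hS).2
    obtain ⟨w₁, hw₁, hw₁'⟩ := exists_mem_subtorusFinset_sdiff hv₁ (G := F₁)
    obtain ⟨w₂, hw₂, hw₂'⟩ := exists_mem_subtorusFinset_sdiff hv₂ (G := F₂)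
    refine Finset.mem_image.2 ⟨⟨(F₁, F₂), ⟨w₁, S₁⟩, ⟨w₂, S₂⟩⟩, Finset.mem_filter.2 ⟨?_, hS⟩, rfl⟩
    simp only [Finset.mem_sigma, Finset.mem_product, P, U, Finset.mem_filter, Finset.mem_univ,
      true_and]
    exact ⟨⟨hF₁, hF₂, hcard, hm₁, hm₂⟩, ⟨hw₁, h₁.of_mem hw₁'⟩, ⟨hw₂, h₂.of_mem hw₂'⟩⟩
  calc mergeWeight p m F v
      ≤ ∑ S ∈ I.image fun x => x.2.1.2 ∪ x.2.2.2, p ^ S.card :=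
        Finset.sum_le_sum_of_subset_of_nonneg hsub fun _ _ _ => pow_nonneg hp _
    _ ≤ ∑ x ∈ I, p ^ (x.2.1.2 ∪ x.2.2.2).card :=
        Finset.sum_image_le_of_nonneg fun _ _ => pow_nonneg hp _
    _ = ∑ x ∈ I, p ^ x.2.1.2.card * p ^ x.2.2.2.card := Finset.sum_congr rfl fun x hx => by
        rw [Finset.card_union_of_disjoint (Finset.mem_filter.1 hx).2, pow_add]
    _ ≤ ∑ x ∈ P.sigma fun q => U q.1 ×ˢ U q.2, p ^ x.2.1.2.card * p ^ x.2.2.2.card :=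
        Finset.sum_le_sum_of_subset_of_nonneg (Finset.filter_subset _ _) fun _ _ _ =>
          mul_nonneg (pow_nonneg hp _) (pow_nonneg hp _)
    _ = ∑ q ∈ P, (∑ x ∈ U q.1, p ^ x.2.card) * ∑ x ∈ U q.2, p ^ x.2.card := by
        rw [Finset.sum_sigma]
        exact Finset.sum_congr rfl fun q _ => by rw [Finset.sum_mul_sum, ← Finset.sum_product']
    _ ≤ ∑ q ∈ P, X := by
        refine Finset.sum_le_sum fun q hq => ?_
        obtain ⟨h₁, h₂, hcard, hm₁, hm₂⟩ := (Finset.mem_filter.1 hq).2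
        refine (mul_le_mul (hU _ h₁.subset hm₁) (hU _ h₂.subset hm₂)
          (Finset.sum_nonneg fun _ _ => pow_nonneg hp _) ?_).trans
          (hX _ _ hm₁ hm₂ (Finset.card_lt_card h₁) (Finset.card_lt_card h₂) hcard)
        exact (Finset.sum_nonneg fun _ _ => pow_nonneg hp _).trans (hU _ h₁.subset hm₁)
    _ ≤ 4 ^ d * X := by
        rw [Finset.sum_const, nsmul_eq_mul]
        refine mul_le_mul_of_nonneg_right ?_ hX0
        have h1 : P.card ≤ 4 ^ d := by
          refine (Finset.card_le_univ P).trans ?_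
          simp only [Fintype.card_prod, Fintype.card_finset, Fintype.card_fin]
          rw [← mul_pow]
          norm_num
        exact_mod_cast h1

/-- The exponent of `n` in the bound for the weight of a subtorus of dimension `i`. -/
def weightExp (J i : ℕ) : ℤ := ((i : ℤ) ^ 2 + 2 * i) / 4 - i * J - 2 * J - 2

theorem four_mul_weightExp_le (J i : ℕ) :
    4 * weightExp J i ≤ (i : ℤ) ^ 2 + 2 * i - 4 * i * J - 8 * J - 8 := by
  rw [weightExp]
  have := Int.ediv_mul_le ((i : ℤ) ^ 2 + 2 * i) (show (4 : ℤ) ≠ 0 by norm_num)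
  linarith

/-- As `x` is an integer, the floor in `weightExp` costs nothing here; all comparisons of exponents
reduce to quadratic inequalities without division. -/
theorem le_weightExp {J i : ℕ} {x : ℤ}
    (h : 4 * x ≤ (i : ℤ) ^ 2 + 2 * i - 4 * i * J - 8 * J - 8) : x ≤ weightExp J i := by
  have : x + i * J + 2 * J + 2 ≤ ((i : ℤ) ^ 2 + 2 * i) / 4 := by
    rw [Int.le_ediv_iff_mul_le (by norm_num)]
    linarith
  rw [weightExp]
  linarith

/-- The exponent is superadditive along merges up to dimension `2J + 1`, which closes the recursion
for the weights. -/
theorem weightExp_add_le {J i i₁ i₂ : ℕ} (hi : i ≤ 2 * J + 1) (h₁ : i₁ < i) (h₂ : i₂ < i)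
    (h : i ≤ i₁ + i₂ + 2) :
    ((i - i₁ : ℕ) : ℤ) + weightExp J i₁ + (((i - i₂ : ℕ) : ℤ) + weightExp J i₂) ≤
      weightExp J i := by
  apply le_weightExp
  have e₁ := four_mul_weightExp_le J i₁
  have e₂ := four_mul_weightExp_le J i₂
  rw [Nat.cast_sub h₁.le, Nat.cast_sub h₂.le]
  obtain ⟨δ, hδ⟩ := Nat.exists_eq_add_of_le h
  have hδ' : (i : ℤ) = i₁ + i₂ + 2 - δ := by omega
  have hδ₁ : (δ : ℤ) ≤ i₁ + 1 := by omega
  have hδ₂ : (δ : ℤ) ≤ i₂ + 1 := by omega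
  have hJ : (i : ℤ) ≤ 2 * J + 1 := by omega
  -- Here `δ` is the shortfall from the maximal dimension `i₁ + i₂ + 2`. With `i ≤ 2J + 1` and `i₁,
  -- i₂ ≥ δ - 1` the expression is at least `δ(4 - δ) + 2(δ - 1)² = δ² + 2` when `δ ≥ 1`.
  suffices 0 ≤ 2 * (i₁ : ℤ) * i₂ + δ * (6 + 4 * J - 2 * i - δ) by
    rw [hδ'] at this ⊢
    nlinarith
  have h4 : (δ : ℤ) * (4 - δ) ≤ δ * (6 + 4 * J - 2 * i - δ) :=
    mul_le_mul_of_nonneg_left (by linarith) (by positivity)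
  rcases Nat.eq_zero_or_pos δ with h0 | h0
  · subst h0
    simp only [Nat.cast_zero, zero_mul, add_zero]
    positivity
  · have h5 : ((δ : ℤ) - 1) * (δ - 1) ≤ i₁ * i₂ :=
      mul_le_mul (by linarith) (by linarith) (by omega) (by positivity)
    nlinarith [sq_nonneg (δ : ℤ)]

/-- With codimensions `b₁, b₂` below `2J`, four times the sum of the first four terms is at most
`-4J² + 4J + (b₁ + b₂)(b₁ + b₂ - 2) - 2b₁b₂`. At `b₁ = b₂ = 0` this is negative only for `J > 1`;
for `J = 1` it vanishes, which is the exceptional case. -/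
theorem weightExp_add_lt {J i₁ i₂ : ℕ} (hJ : 1 < J) (h₁ : i₁ ≤ 2 * J) (h₂ : i₂ ≤ 2 * J)
    (h : 2 * J + 1 ≤ i₁ + i₂) :
    weightExp J i₁ + weightExp J i₂ + 2 + (J + 1) * (J + 2) ≤ -1 := by
  have e₁ := four_mul_weightExp_le J i₁
  have e₂ := four_mul_weightExp_le J i₂
  obtain ⟨b₁, hb₁⟩ := Nat.exists_eq_add_of_le h₁
  obtain ⟨b₂, hb₂⟩ := Nat.exists_eq_add_of_le h₂
  have hb : (b₁ : ℤ) + b₂ ≤ 2 * J - 1 := by omega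
  have hi₁ : (i₁ : ℤ) = 2 * J - b₁ := by omega
  have hi₂ : (i₂ : ℤ) = 2 * J - b₂ := by omega
  rw [hi₁] at e₁
  rw [hi₂] at e₂
  have hJ' : (2 : ℤ) ≤ J := by exact_mod_cast hJ
  have h3 : ((b₁ : ℤ) + b₂) * (b₁ + b₂ - 2) < 4 * J * J - 4 * J := by
    have hs : (0 : ℤ) ≤ b₁ + b₂ := by positivity
    nlinarith [mul_nonneg hs (sub_nonneg.2 hb)]
  have h4 : (0 : ℤ) ≤ b₁ * b₂ := by positivity
  nlinarith

/-- Without the floor the sum would be `-1/4`; integrality improves this to a full factor `1 / n`.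
-/
theorem weightExp_two_mul_add_one (J : ℕ) :
    ((J + 1) * (J + 2) - (2 * J + 1) : ℤ) + weightExp J (2 * J + 1) ≤ -1 := by
  have e := four_mul_weightExp_le J (2 * J + 1)
  push_cast at e
  have : 4 * (((J + 1) * (J + 2) - (2 * J + 1) : ℤ) + weightExp J (2 * J + 1)) ≤ -1 := by
    nlinarith
  omega

/-- The weight of a subtorus of dimension `i ≤ 2J + 1` is at most a constant multiple of
`n ^ weightExp J i`. -/
theorem exists_weight_le (d J : ℕ) (a : ℝ) (m : ℕ) (hm : m ≤ 2 * J + 1) :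
    ∃ C : ℝ, 0 ≤ C ∧ ∀ n : ℕ, 1 ≤ n → ∀ p : ℝ, 0 ≤ p → p ≤ a * (n : ℝ) ^ (-2 * (J : ℤ) - 2) →
      ∀ (F : Finset (Fin d)) (v : Node d n), F.card ≤ m →
        weight p F v ≤ C * (n : ℝ) ^ weightExp J F.card := by
  induction m with
  | zero =>
    refine ⟨|a|, abs_nonneg a, fun n hn p hp hpa F v hF => ?_⟩
    obtain rfl : F = ∅ := by simpa using hF
    refine (weight_empty_le hp v).trans (hpa.trans ?_)
    have : weightExp J (∅ : Finset (Fin d)).card = -2 * (J : ℤ) - 2 := by simp [weightExp]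
    rw [this]
    exact mul_le_mul_of_nonneg_right (le_abs_self a) (by positivity)
  | succ m ih =>
    obtain ⟨C, hC, h⟩ := ih (by omega)
    refine ⟨max C (4 ^ d * (C * C)), le_max_of_le_left hC, fun n hn p hp hpa F v hF => ?_⟩
    have hn' : (1 : ℝ) ≤ n := by exact_mod_cast hn
    have hn0 : (n : ℝ) ≠ 0 := by positivity
    rcases Nat.lt_or_ge m F.card with hlt | hle
    · have hFm : F.card = m + 1 := le_antisymm hF hlt
      have hne : F ≠ ∅ := by
        rintro rfl
        simp at hFm
      have key := mergeWeight_le hp m F v (fun i => C * (n : ℝ) ^ weightExp J i)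
        (fun G u hG => h n hn p hp hpa G u hG) (C * C * (n : ℝ) ^ weightExp J F.card)
        (by positivity) fun i₁ i₂ _ _ h₁ h₂ h12 => by
          have hexp := weightExp_add_le (J := J) (by omega) h₁ h₂ h12
          have := zpow_le_zpow_right₀ hn' hexp
          rw [zpow_add₀ hn0, zpow_add₀ hn0, zpow_add₀ hn0, zpow_natCast, zpow_natCast] at this
          calc _ = C * C * ((n : ℝ) ^ (F.card - i₁) * (n : ℝ) ^ weightExp J i₁ *
                ((n : ℝ) ^ (F.card - i₂) * (n : ℝ) ^ weightExp J i₂)) := by ring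
            _ ≤ _ := mul_le_mul_of_nonneg_left this (by positivity)
      refine (weight_le_mergeWeight hp hne v).trans ?_
      rw [hFm, Nat.add_sub_cancel, ← hFm]
      refine key.trans ?_
      rw [← mul_assoc]
      exact mul_le_mul_of_nonneg_right (le_max_right _ _) (by positivity)
    · exact (h n hn p hp hpa F v hle).trans
        (mul_le_mul_of_nonneg_right (le_max_left _ _) (by positivity))

theorem WitMerge.of_mem {m : ℕ} {S : Finset (Node d n)} {F : Finset (Fin d)} {v u : Node d n}
    (h : WitMerge m S F v) (hu : u ∈ subtorus F v) : WitMerge m S F u := by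
  rwa [WitMerge, subtorus_eq hu]

/-- For `J > 1`, the probability that the whole torus but no subtorus of dimension `2J + 2` is
internally spanned is at most of order `1 / n`. -/
theorem exists_real_spannedEvent_diff_le (J : ℕ) (hJ : 1 < J) (a : ℝ) :
    ∃ K : ℝ, ∀ n : ℕ, 2 ≤ n → ∀ p : unitInterval, (p : ℝ) = a * (n : ℝ) ^ (-2 * (J : ℤ) - 2) →
      (initialLaw ((J + 1) * (J + 2)) n p).real
        (spannedEvent ((J + 1) * (J + 2)) n ((J + 1) * (J + 2)) \
          spannedEvent ((J + 1) * (J + 2)) n (2 * J + 2)) ≤ K * (n : ℝ)⁻¹ := by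
  classical
  generalize hd : (J + 1) * (J + 2) = d
  have hdJ : 2 * J < d := by nlinarith
  have hdZ : ((J : ℤ) + 1) * (J + 2) = d := by exact_mod_cast hd
  obtain ⟨C, hC, hw⟩ := exists_weight_le d J a (2 * J + 1) le_rfl
  refine ⟨2 ^ d * (C + 4 ^ d * (C * C)), fun n hn p hp => ?_⟩
  have hp0 : (0 : ℝ) ≤ p := p.2.1
  have hn1 : 1 ≤ n := by omega
  have hn' : (1 : ℝ) ≤ n := by exact_mod_cast hn1
  have hn0 : (n : ℝ) ≠ 0 := by positivity
  let v₀ : Node d n := fun _ => ⟨0, by omega⟩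
  let fam : Finset (Fin d) → Node d n → Finset (Finset (Node d n)) := fun F v =>
    Finset.univ.filter fun S =>
      F.card = 2 * J + 1 ∧ Wit S F v ∨ 2 * J + 3 ≤ F.card ∧ WitMerge (2 * J) S F v
  -- Fixing the free coordinates of the base node to those of `v₀` counts each subtorus once, giving
  -- `n ^ Fᶜ.card` positions.
  have hsub : spannedEvent d n d \ spannedEvent d n (2 * J + 2) ⊆
      ⋃ F ∈ (Finset.univ : Finset (Finset (Fin d))), ⋃ v ∈ subtorusFinset Fᶜ v₀,
        {ω | ∃ S ∈ fam F v, (S : Set (Node d n)) ⊆ ω} := by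
    intro ω hω
    obtain ⟨S, F, v, hS, h⟩ := exists_wit_of_mem_spannedEvent hn hdJ hω
    obtain ⟨w, hw, hw'⟩ := exists_mem_subtorusFinset_sdiff (F := Finset.univ) (G := F) (v := v₀)
      (u := v) fun l hl => absurd (Finset.mem_univ l) hl
    simp only [Set.mem_iUnion, exists_prop]
    refine ⟨F, Finset.mem_univ F, w, by rwa [Finset.compl_eq_univ_sdiff], S, ?_, hS⟩
    simp only [fam, Finset.mem_filter, Finset.mem_univ, true_and]
    exact h.imp (fun h => ⟨h.1, h.2.of_mem hw'⟩) fun h => ⟨h.1, h.2.of_mem hw'⟩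
  have hfam : ∀ F v, (n : ℝ) ^ Fᶜ.card * ∑ S ∈ fam F v, (p : ℝ) ^ S.card ≤
      (C + 4 ^ d * (C * C)) * (n : ℝ)⁻¹ := by
    intro F v
    have hFd : F.card ≤ d := by simpa using F.card_le_univ
    have hcompl : ((Fᶜ.card : ℕ) : ℤ) = d - F.card := by
      rw [Finset.card_compl, Fintype.card_fin, Nat.cast_sub hFd]
    rw [← zpow_natCast, hcompl, ← zpow_neg_one]
    by_cases h1 : F.card = 2 * J + 1
    · have hle : ∑ S ∈ fam F v, (p : ℝ) ^ S.card ≤ weight p F v := by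
        refine Finset.sum_le_sum_of_subset_of_nonneg (fun S hS => ?_) fun _ _ _ => pow_nonneg hp0 _
        simp only [fam, Finset.mem_filter, Finset.mem_univ, true_and] at hS ⊢
        exact hS.elim (fun h => h.2) fun h => by omega
      have hexp := weightExp_two_mul_add_one J
      rw [hdZ] at hexp
      have hz := zpow_le_zpow_right₀ hn' hexp
      rw [zpow_add₀ hn0] at hz
      calc _ ≤ (n : ℝ) ^ ((d : ℤ) - F.card) * (C * (n : ℝ) ^ weightExp J F.card) :=
            mul_le_mul_of_nonneg_left (hle.trans (hw n hn1 p hp0 hp.le F v h1.le)) (by positivity)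
        _ = C * ((n : ℝ) ^ ((d : ℤ) - (2 * J + 1)) * (n : ℝ) ^ weightExp J (2 * J + 1)) := by
            rw [h1]
            push_cast
            ring
        _ ≤ C * (n : ℝ) ^ (-1 : ℤ) := mul_le_mul_of_nonneg_left hz hC
        _ ≤ _ := mul_le_mul_of_nonneg_right (le_add_of_nonneg_right (by positivity))
            (by positivity)
    · by_cases h3 : 2 * J + 3 ≤ F.card
      · have hle : ∑ S ∈ fam F v, (p : ℝ) ^ S.card ≤ mergeWeight p (2 * J) F v := by
          refine Finset.sum_le_sum_of_subset_of_nonneg (fun S hS => ?_)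
            fun _ _ _ => pow_nonneg hp0 _
          simp only [fam, Finset.mem_filter, Finset.mem_univ, true_and] at hS ⊢
          exact hS.elim (fun h => by omega) fun h => h.2
        have key := mergeWeight_le hp0 (2 * J) F v (fun i => C * (n : ℝ) ^ weightExp J i)
          (fun G u hG => hw n hn1 p hp0 hp.le G u (by omega))
          (C * C * (n : ℝ) ^ (-1 - (d - F.card : ℤ)))
          (by positivity) fun i₁ i₂ hm₁ hm₂ h₁ h₂ h12 => by
            -- The positions of the two parts and of `F` give the exponent `d + F.card - i₁ - i₂ ≤ d
            -- + 2`, and here `J > 1` enters.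
            have hexp := weightExp_add_lt hJ hm₁ hm₂ (by omega)
            rw [hdZ] at hexp
            have hexp' : ((F.card - i₁ : ℕ) : ℤ) + weightExp J i₁ +
                (((F.card - i₂ : ℕ) : ℤ) + weightExp J i₂) ≤ -1 - (d - F.card : ℤ) := by
              omega
            have := zpow_le_zpow_right₀ hn' hexp'
            rw [zpow_add₀ hn0 (_ + _), zpow_add₀ hn0 ((F.card - i₁ : ℕ) : ℤ),
              zpow_add₀ hn0 ((F.card - i₂ : ℕ) : ℤ), zpow_natCast, zpow_natCast] at this
            calc _ = C * C * ((n : ℝ) ^ (F.card - i₁) * (n : ℝ) ^ weightExp J i₁ *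
                  ((n : ℝ) ^ (F.card - i₂) * (n : ℝ) ^ weightExp J i₂)) := by ring
              _ ≤ _ := mul_le_mul_of_nonneg_left this (by positivity)
        calc _ ≤ (n : ℝ) ^ ((d : ℤ) - F.card) *
              (4 ^ d * (C * C * (n : ℝ) ^ (-1 - (d - F.card : ℤ)))) :=
              mul_le_mul_of_nonneg_left (hle.trans key) (by positivity)
          _ = 4 ^ d * (C * C) *
              ((n : ℝ) ^ ((d : ℤ) - F.card) * (n : ℝ) ^ (-1 - (d - F.card : ℤ))) := by ring
          _ = 4 ^ d * (C * C) * (n : ℝ) ^ (-1 : ℤ) := by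
              rw [← zpow_add₀ hn0]
              congr 2
              ring
          _ ≤ _ := mul_le_mul_of_nonneg_right (le_add_of_nonneg_left hC) (by positivity)
      · have : fam F v = ∅ := Finset.filter_eq_empty_iff.2 fun S _ => by
          rintro (h | h)
          · exact h1 h.1
          · exact h3 h.1
        rw [this, Finset.sum_empty, mul_zero]
        positivity
  calc _ ≤ (setBernoulli Set.univ p).real
        (⋃ F ∈ (Finset.univ : Finset (Finset (Fin d))), ⋃ v ∈ subtorusFinset Fᶜ v₀,
          {ω | ∃ S ∈ fam F v, (S : Set (Node d n)) ⊆ ω}) := measureReal_mono hsub (measure_ne_top _ _)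
    _ ≤ ∑ F : Finset (Fin d), ∑ v ∈ subtorusFinset Fᶜ v₀,
        ∑ S ∈ fam F v, (p : ℝ) ^ S.card := by
      refine (measureReal_biUnion_finset_le _ _).trans (Finset.sum_le_sum fun F _ => ?_)
      refine (measureReal_biUnion_finset_le _ _).trans (Finset.sum_le_sum fun v _ => ?_)
      exact setBernoulli_real_exists_superset_le _
    _ ≤ ∑ _F : Finset (Fin d), (C + 4 ^ d * (C * C)) * (n : ℝ)⁻¹ := by
      refine Finset.sum_le_sum fun F _ => ?_
      have hpos : (0 : ℝ) < (n : ℝ) ^ Fᶜ.card := by positivity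
      refine (Finset.sum_le_card_nsmul _ _
        ((C + 4 ^ d * (C * C)) * (n : ℝ)⁻¹ / (n : ℝ) ^ Fᶜ.card) fun v _ => ?_).trans_eq ?_
      · rw [le_div_iff₀' hpos]
        exact hfam F v
      · rw [card_subtorusFinset, nsmul_eq_mul, Nat.cast_pow, mul_div_cancel₀ _ hpos.ne']
    _ = _ := by simp [mul_assoc]

end Weight

/-! ### The case `J = 1`: two planes that jump to dimension six -/

section SixDimensional

variable {n : ℕ}

theorem hammingDist_le_card_of_mem {d : ℕ} {F : Finset (Fin d)} {u v : Node d n}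
    (h : u ∈ subtorus F v) : hammingDist u v ≤ F.card := by
  refine Finset.card_le_card fun l hl => ?_
  by_contra hF
  simp [h l hF] at hl

/-- Nodes that are far from each other and from the subtorus share no neighbor with anything else in
the union, so nothing new opens. -/
theorem closed_subtorus_union {d : ℕ} {F : Finset (Fin d)} {v : Node d n} {R : Set (Node d n)}
    (hR : ∀ u ∈ R, ∀ w ∈ R, u ≠ w → 2 < hammingDist u w)
    (hF : ∀ u ∈ R, 2 < (gap F v ∅ u).card) : Closed (subtorus F v ∪ R) := by
  intro x u w hu hw huw hxu hxw
  have htri := hammingDist_triangle u x w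
  rw [hammingDist_comm u x] at htri
  rcases hu with hu | hu <;> rcases hw with hw | hw
  · exact Or.inl (closed_subtorus F v x u w hu hw huw hxu hxw)
  · have h1 := hF w hw
    have h2 := card_gap_le_hammingDist hu (self_mem_subtorus ∅ w)
    omega
  · have h1 := hF u hu
    have h2 := card_gap_le_hammingDist hw (self_mem_subtorus ∅ u)
    rw [hammingDist_comm] at h2
    omega
  · have h1 := hR u hu w hw huw
    omega

/-- A larger subtorus has a direction outside `F`. Two adjacent nodes along it cannot both lie in
`subtorus F v`, and any other placement puts an element of `R` too close to another node of the
union. -/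
theorem not_subtorus_subset_union (hn : 2 ≤ n) {d : ℕ} {F G : Finset (Fin d)} {v x : Node d n}
    {R : Set (Node d n)} (hR : ∀ u ∈ R, ∀ w ∈ R, u ≠ w → 2 < hammingDist u w)
    (hF : ∀ u ∈ R, 2 < (gap F v ∅ u).card) (hFG : F.card < G.card) :
    ¬ subtorus G x ⊆ subtorus F v ∪ R := by
  intro hsub
  obtain ⟨l, hlG, hlF⟩ := Finset.exists_mem_notMem_of_card_lt_card hFG
  have : Nontrivial (Fin n) := Fin.nontrivial_iff_two_le.2 hn
  obtain ⟨c, hc⟩ := exists_ne (x l)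
  have hdist := hammingDist_update_eq x l c hc
  have hu : Function.update x l c ∈ subtorus G x := fun j hj => by
    rw [Function.update_of_ne]
    rintro rfl
    exact hj hlG
  rcases hsub (self_mem_subtorus G x) with h1 | h1 <;> rcases hsub hu with h2 | h2
  · have h3 := h2 l hlF
    rw [Function.update_self, ← h1 l hlF] at h3
    exact hc h3
  · have h3 := hF _ h2
    have h4 := card_gap_le_hammingDist h1 (self_mem_subtorus ∅ (Function.update x l c))
    omega
  · have h3 := hF _ h1
    have h4 := card_gap_le_hammingDist h2 (self_mem_subtorus ∅ x)
    rw [hammingDist_comm] at h4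
    omega
  · have h3 := hR _ h1 _ h2 (by
      rintro h
      rw [← h, hammingDist_self] at hdist
      omega)
    omega

/-- Two pairs of nodes that span planes in the coordinate directions `{0, 1}` and `{2, 3}`, at
distance two from each other, while each node is at distance more than two from the plane spanned
by the other pair. -/
structure IsTwoPairs (x y z w : Node 6 n) : Prop where
  mem_left : y ∈ subtorus {0, 1} x
  lt_left : x 0 < y 0
  ne_left : x 1 ≠ y 1
  mem_right : w ∈ subtorus {2, 3} z
  lt_right : z 2 < w 2
  ne_right : z 3 ≠ w 3
  ne_four : x 4 ≠ z 4
  ne_five : x 5 ≠ z 5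
  ne_one : x 1 ≠ z 1
  ne_zero : y 0 ≠ z 0
  ne_three : x 3 ≠ z 3
  ne_two : x 2 ≠ w 2

/-- The only pairs of nodes of `ω` at distance at most two are `x, y` and `z, w`, and no other node
of `ω` is at distance at most two from one of the planes spanned by these pairs. -/
structure IsIsolated (ω : Set (Node 6 n)) (x y z w : Node 6 n) : Prop where
  mem_x : x ∈ ω
  mem_y : y ∈ ω
  mem_z : z ∈ ω
  mem_w : w ∈ ω
  close : ∀ u ∈ ω, ∀ v ∈ ω, u ≠ v → hammingDist u v ≤ 2 →
    u = x ∧ v = y ∨ u = y ∧ v = x ∨ u = z ∧ v = w ∨ u = w ∧ v = z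
  far_left : ∀ u ∈ ω, (gap {0, 1} x ∅ u).card ≤ 2 → u = x ∨ u = y
  far_right : ∀ u ∈ ω, (gap {2, 3} z ∅ u).card ≤ 2 → u = z ∨ u = w

/-- The two planes differ in coordinates 4 and 5 only up to their free directions, so they merge.
Each of the last four fields of `IsTwoPairs` provides the third differing coordinate that keeps one
node away from the opposite plane. -/
theorem IsTwoPairs.gap_left_z {x y z w : Node 6 n} (h : IsTwoPairs x y z w) :
    2 < (gap {0, 1} x ∅ z).card :=
  Finset.two_lt_card.2 ⟨3, mem_gap.2 ⟨by decide, by simp, h.ne_three⟩,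
    4, mem_gap.2 ⟨by decide, by simp, h.ne_four⟩, 5, mem_gap.2 ⟨by decide, by simp, h.ne_five⟩,
    by decide, by decide, by decide⟩

theorem IsTwoPairs.gap_left_w {x y z w : Node 6 n} (h : IsTwoPairs x y z w) :
    2 < (gap {0, 1} x ∅ w).card := by
  have h4 : w 4 = z 4 := h.mem_right 4 (by decide)
  have h5 : w 5 = z 5 := h.mem_right 5 (by decide)
  exact Finset.two_lt_card.2 ⟨2, mem_gap.2 ⟨by decide, by simp, h.ne_two⟩,
    4, mem_gap.2 ⟨by decide, by simp, h4 ▸ h.ne_four⟩,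
    5, mem_gap.2 ⟨by decide, by simp, h5 ▸ h.ne_five⟩, by decide, by decide, by decide⟩

theorem IsTwoPairs.gap_right_x {x y z w : Node 6 n} (h : IsTwoPairs x y z w) :
    2 < (gap {2, 3} z ∅ x).card :=
  Finset.two_lt_card.2 ⟨1, mem_gap.2 ⟨by decide, by simp, h.ne_one.symm⟩,
    4, mem_gap.2 ⟨by decide, by simp, h.ne_four.symm⟩,
    5, mem_gap.2 ⟨by decide, by simp, h.ne_five.symm⟩, by decide, by decide, by decide⟩

theorem IsTwoPairs.gap_right_y {x y z w : Node 6 n} (h : IsTwoPairs x y z w) :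
    2 < (gap {2, 3} z ∅ y).card := by
  have h4 : y 4 = x 4 := h.mem_left 4 (by decide)
  have h5 : y 5 = x 5 := h.mem_left 5 (by decide)
  exact Finset.two_lt_card.2 ⟨0, mem_gap.2 ⟨by decide, by simp, h.ne_zero.symm⟩,
    4, mem_gap.2 ⟨by decide, by simp, h4 ▸ h.ne_four.symm⟩,
    5, mem_gap.2 ⟨by decide, by simp, h5 ▸ h.ne_five.symm⟩, by decide, by decide, by decide⟩

/-- The two pairs are determined by a configuration in which they are isolated. -/
theorem IsIsolated.eq_of_isTwoPairs {ω : Set (Node 6 n)} {x y z w x' y' z' w' : Node 6 n}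
    (hω : IsIsolated ω x y z w) (h : IsTwoPairs x y z w) (hω' : IsIsolated ω x' y' z' w')
    (h' : IsTwoPairs x' y' z' w') : x' = x ∧ y' = y ∧ z' = z ∧ w' = w := by
  have hlt := h.lt_left
  have hlt' := h'.lt_left
  have hgt := h.lt_right
  have hgt' := h'.lt_right
  have h0 : w 0 = z 0 := h.mem_right 0 (by decide)
  have h2 : y 2 = x 2 := h.mem_left 2 (by decide)
  have hxy : x' ≠ y' := fun e => by simp [e] at hlt'
  have hzw : z' ≠ w' := fun e => by simp [e] at hgt'
  have h3 := hω.close x' hω'.mem_x y' hω'.mem_y hxy (by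
    rw [hammingDist_comm]
    exact hammingDist_le_card_of_mem h'.mem_left)
  have h4 := hω.close z' hω'.mem_z w' hω'.mem_w hzw (by
    rw [hammingDist_comm]
    exact hammingDist_le_card_of_mem h'.mem_right)
  -- The strict order in coordinate 0 excludes swapping the two nodes, and the other pair is
  -- constant in coordinate 0.
  have h5 : x' = x ∧ y' = y := by
    rcases h3 with h3 | ⟨rfl, rfl⟩ | ⟨rfl, rfl⟩ | ⟨rfl, rfl⟩
    · exact h3
    · exact absurd hlt (lt_asymm hlt')
    · exact absurd h0.symm hlt'.ne
    · exact absurd h0 hlt'.ne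
  have h6 : z' = z ∧ w' = w := by
    rcases h4 with ⟨rfl, rfl⟩ | ⟨rfl, rfl⟩ | h4 | ⟨rfl, rfl⟩
    · exact absurd h2.symm hgt'.ne
    · exact absurd h2 hgt'.ne
    · exact h4
    · exact absurd hgt (lt_asymm hgt')
  exact ⟨h5.1, h5.2, h6.1, h6.2⟩

theorem Closed.subtorus_pair_subset {d : ℕ} {C : Set (Node d n)} (hC : Closed C) {u v : Node d n}
    (hu : u ∈ C) (hv : v ∈ C) {k l : Fin d} (hk : u k ≠ v k) (hl : u l ≠ v l)
    (h : v ∈ subtorus {k, l} u) : subtorus {k, l} u ⊆ C := by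
  have hsing : ∀ t : Node d n, t ∈ C → subtorus ∅ t ⊆ C := fun t ht s hs => by
    have : s = t := funext fun j => hs j (by simp)
    rwa [this]
  refine hC.subtorus_subset_of_merge (hsing u hu) (hsing v hv) (Finset.empty_subset _)
    (Finset.empty_subset _) (self_mem_subtorus _ u) h ?_ ?_
  · intro j hj
    rcases Finset.mem_insert.1 hj with rfl | hj
    · exact Or.inr (Or.inr hk)
    · rw [Finset.mem_singleton] at hj
      subst hj
      exact Or.inr (Or.inr hl)
  · simpa using Finset.card_le_two

theorem IsTwoPairs.mem_closed {x y z w : Node 6 n} (h : IsTwoPairs x y z w) {C : Set (Node 6 n)}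
    (hC : Closed C) (hx : x ∈ C) (hy : y ∈ C) (hz : z ∈ C) (hw : w ∈ C) (u : Node 6 n) :
    u ∈ C := by
  have h1 := hC.subtorus_pair_subset hx hy h.lt_left.ne h.ne_left h.mem_left
  have h2 := hC.subtorus_pair_subset hz hw h.lt_right.ne h.ne_right h.mem_right
  have htriv : ∀ s t : Node 6 n, s ∈ subtorus Finset.univ t := fun s t l hl =>
    absurd (Finset.mem_univ l) hl
  refine hC.subtorus_subset_of_merge (F := Finset.univ) (v := x) h1 h2 (Finset.subset_univ _)
    (Finset.subset_univ _) (htriv _ _) (htriv _ _) ?_ (by decide) (htriv u x)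
  intro l _
  by_cases h4 : l = 4
  · subst h4
    exact Or.inr (Or.inr h.ne_four)
  by_cases h5 : l = 5
  · subst h5
    exact Or.inr (Or.inr h.ne_five)
  · have : l ∈ ({0, 1} : Finset (Fin 6)) ∨ l ∈ ({2, 3} : Finset (Fin 6)) := by
      revert l
      decide
    tauto

/-- The two planes merge to the whole torus. A subtorus containing both pairs must be everything, so
a four-dimensional one misses a node of some pair; the open nodes inside it then lie in one plane
together with isolated nodes, and this union is closed. -/
theorem IsIsolated.mem_spannedEvent_diff (hn : 2 ≤ n) {ω : Set (Node 6 n)} {x y z w : Node 6 n}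
    (hω : IsIsolated ω x y z w) (h : IsTwoPairs x y z w) :
    ω ∈ spannedEvent 6 n 6 \ spannedEvent 6 n 4 := by
  constructor
  · refine ⟨_, by simpa using isSubtorus_subtorus Finset.univ x, ?_⟩
    have huniv : subtorus Finset.univ x = Set.univ := Set.eq_univ_of_forall fun u l hl =>
      absurd (Finset.mem_univ l) hl
    rw [huniv, InternallySpans, Set.inter_univ]
    exact (Set.eq_univ_of_forall (h.mem_closed (closed_span ω) (subset_span ω hω.mem_x)
      (subset_span ω hω.mem_y) (subset_span ω hω.mem_z) (subset_span ω hω.mem_w))).symm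
  · rintro ⟨V, hV, hspan⟩
    obtain ⟨G, v, hG, rfl⟩ := hV.exists_eq
    have hmemG : ∀ s ∈ subtorus G v, ∀ t ∈ subtorus G v, ∀ l, s l ≠ t l → l ∈ G := by
      intro s hs t ht l hl
      by_contra hlG
      exact hl ((hs l hlG).trans (ht l hlG).symm)
    have key : ∀ F : Finset (Fin 6), F.card < 4 → ∀ s : Node 6 n,
        ¬ ((∀ u ∈ (ω ∩ subtorus G v) \ subtorus F s, ∀ t ∈ (ω ∩ subtorus G v) \ subtorus F s,
            u ≠ t → 2 < hammingDist u t) ∧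
          ∀ u ∈ (ω ∩ subtorus G v) \ subtorus F s, 2 < (gap F s ∅ u).card) := by
      rintro F hF s ⟨h1, h2⟩
      refine not_subtorus_subset_union hn h1 h2 (hF.trans_eq hG.symm) (x := v) ?_
      rw [hspan]
      refine span_subset (closed_subtorus_union ?_ ?_) ?_
      · rwa [← hspan]
      · rwa [← hspan]
      · intro u hu
        by_cases hs : u ∈ subtorus F s
        · exact Or.inl hs
        · exact Or.inr ⟨by rwa [← hspan], hs⟩
    by_cases hxy : x ∈ subtorus G v ∧ y ∈ subtorus G v
    · by_cases hzw : z ∈ subtorus G v ∧ w ∈ subtorus G v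
      · have : G = Finset.univ := by
          refine Finset.eq_univ_iff_forall.2 fun l => ?_
          fin_cases l
          · exact hmemG x hxy.1 y hxy.2 _ h.lt_left.ne
          · exact hmemG x hxy.1 y hxy.2 _ h.ne_left
          · exact hmemG z hzw.1 w hzw.2 _ h.lt_right.ne
          · exact hmemG z hzw.1 w hzw.2 _ h.ne_right
          · exact hmemG x hxy.1 z hzw.1 _ h.ne_four
          · exact hmemG x hxy.1 z hzw.1 _ h.ne_five
        simp [this] at hG
      · refine key {0, 1} (by decide) x ⟨fun u hu t ht hut => ?_, fun u hu => ?_⟩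
        · by_contra hle
          rcases hω.close u hu.1.1 t ht.1.1 hut (not_lt.1 hle) with
            ⟨rfl, rfl⟩ | ⟨rfl, rfl⟩ | ⟨rfl, rfl⟩ | ⟨rfl, rfl⟩
          · exact hu.2 (self_mem_subtorus _ _)
          · exact hu.2 h.mem_left
          · exact hzw ⟨hu.1.2, ht.1.2⟩
          · exact hzw ⟨ht.1.2, hu.1.2⟩
        · by_contra hle
          rcases hω.far_left u hu.1.1 (not_lt.1 hle) with rfl | rfl
          · exact hu.2 (self_mem_subtorus _ _)
          · exact hu.2 h.mem_left
    -- This also covers the case that neither pair lies in the subtorus: an incomplete left pair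
    -- produces no close pair.
    · refine key {2, 3} (by decide) z ⟨fun u hu t ht hut => ?_, fun u hu => ?_⟩
      · by_contra hle
        rcases hω.close u hu.1.1 t ht.1.1 hut (not_lt.1 hle) with
          ⟨rfl, rfl⟩ | ⟨rfl, rfl⟩ | ⟨rfl, rfl⟩ | ⟨rfl, rfl⟩
        · exact hxy ⟨hu.1.2, ht.1.2⟩
        · exact hxy ⟨ht.1.2, hu.1.2⟩
        · exact hu.2 (self_mem_subtorus _ _)
        · exact hu.2 h.mem_right
      · by_contra hle
        rcases hω.far_right u hu.1.1 (not_lt.1 hle) with rfl | rfl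
        · exact hu.2 (self_mem_subtorus _ _)
        · exact hu.2 h.mem_right

/-- Configurations without two nodes at distance at most two and without nodes at distance at
most two from the planes through `x` and `z`. -/
def sparseEvent (x z : Node 6 n) : Set (Set (Node 6 n)) :=
  {ω | (∀ u ∈ ω, ∀ v ∈ ω, u ≠ v → 2 < hammingDist u v) ∧
    ∀ u ∈ ω, 2 < (gap {0, 1} x ∅ u).card ∧ 2 < (gap {2, 3} z ∅ u).card}

theorem IsTwoPairs.isIsolated_union {x y z w : Node 6 n} (h : IsTwoPairs x y z w)
    {ω : Set (Node 6 n)} (hω : ω ∈ sparseEvent x z) :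
    IsIsolated ((({x, y, z, w} : Finset (Node 6 n)) : Set (Node 6 n)) ∪ ω) x y z w := by
  have hmem : ∀ u, u ∈ (({x, y, z, w} : Finset (Node 6 n)) : Set (Node 6 n)) ∪ ω ↔
      (u = x ∨ u = y ∨ u = z ∨ u = w) ∨ u ∈ ω := fun u => by simp
  have hleft : ∀ s ∈ subtorus {0, 1} x, ∀ u, 2 < (gap {0, 1} x ∅ u).card →
      2 < hammingDist s u := fun s hs u hu =>
    hu.trans_le (card_gap_le_hammingDist hs (self_mem_subtorus ∅ u))
  have hright : ∀ s ∈ subtorus {2, 3} z, ∀ u, 2 < (gap {2, 3} z ∅ u).card →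
      2 < hammingDist s u := fun s hs u hu =>
    hu.trans_le (card_gap_le_hammingDist hs (self_mem_subtorus ∅ u))
  have hfar : ∀ u ∈ ω, ∀ s, (s = x ∨ s = y ∨ s = z ∨ s = w) → 2 < hammingDist s u := by
    rintro u hu s (rfl | rfl | rfl | rfl)
    · exact hleft _ (self_mem_subtorus _ _) u (hω.2 u hu).1
    · exact hleft _ h.mem_left u (hω.2 u hu).1
    · exact hright _ (self_mem_subtorus _ _) u (hω.2 u hu).2
    · exact hright _ h.mem_right u (hω.2 u hu).2
  have hcross : ∀ s, (s = x ∨ s = y) → ∀ t, (t = z ∨ t = w) → 2 < hammingDist s t := by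
    intro s hs t ht
    refine hleft s ?_ t ?_
    · rcases hs with rfl | rfl
      exacts [self_mem_subtorus _ _, h.mem_left]
    · rcases ht with rfl | rfl
      exacts [h.gap_left_z, h.gap_left_w]
  refine ⟨(hmem x).2 (by simp), (hmem y).2 (by simp), (hmem z).2 (by simp), (hmem w).2 (by simp),
    ?_, ?_, ?_⟩
  · intro u hu v hv huv hle
    rw [hmem] at hu hv
    rcases hu with hu | hu <;> rcases hv with hv | hv
    · rw [← or_assoc] at hu hv
      rcases hu with hu | hu <;> rcases hv with hv | hv
      · rcases hu with rfl | rfl <;> rcases hv with rfl | rfl <;> simp at huv ⊢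
      · exact absurd hle (not_le.2 (hcross u hu v hv))
      · rw [hammingDist_comm] at hle
        exact absurd hle (not_le.2 (hcross v hv u hu))
      · rcases hu with rfl | rfl <;> rcases hv with rfl | rfl <;> simp at huv ⊢
    · exact absurd hle (not_le.2 (hfar v hv u hu))
    · rw [hammingDist_comm] at hle
      exact absurd hle (not_le.2 (hfar u hu v hv))
    · exact absurd hle (not_le.2 (hω.1 u hu v hv huv))
  · intro u hu hle
    rcases (hmem u).1 hu with (rfl | rfl | rfl | rfl) | hu
    · exact Or.inl rfl
    · exact Or.inr rfl
    · exact absurd hle (not_le.2 h.gap_left_z)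
    · exact absurd hle (not_le.2 h.gap_left_w)
    · exact absurd hle (not_le.2 (hω.2 u hu).1)
  · intro u hu hle
    rcases (hmem u).1 hu with (rfl | rfl | rfl | rfl) | hu
    · exact absurd hle (not_le.2 h.gap_right_x)
    · exact absurd hle (not_le.2 h.gap_right_y)
    · exact Or.inl rfl
    · exact Or.inr rfl
    · exact absurd hle (not_le.2 (hω.2 u hu).2)

theorem IsTwoPairs.card_eq_four {x y z w : Node 6 n} (h : IsTwoPairs x y z w) :
    ({x, y, z, w} : Finset (Node 6 n)).card = 4 := by
  have h1 : x ≠ y := fun e => h.ne_left (congrFun e 1)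
  have h2 : z ≠ w := fun e => h.ne_right (congrFun e 3)
  have h3 : x ≠ z := fun e => h.ne_four (congrFun e 4)
  have h4 : x ≠ w := fun e => h.ne_two (congrFun e 2)
  have h5 : y ≠ z := fun e => h.ne_zero (congrFun e 0)
  have h6 : y ≠ w := fun e => by
    have := congrFun e 4
    rw [h.mem_left 4 (by decide), h.mem_right 4 (by decide)] at this
    exact h.ne_four this
  rw [Finset.card_insert_of_notMem (by simp [h1, h3, h4]),
    Finset.card_insert_of_notMem (by simp [h5, h6]), Finset.card_pair h2]

theorem IsTwoPairs.disjoint_of_mem_sparseEvent {x y z w : Node 6 n} (h : IsTwoPairs x y z w)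
    {ω : Set (Node 6 n)} (hω : ω ∈ sparseEvent x z) :
    Disjoint (({x, y, z, w} : Finset (Node 6 n)) : Set (Node 6 n)) ω := by
  rw [Set.disjoint_left]
  intro u hu huω
  have h1 := hω.2 u huω
  have hzero : ∀ {F : Finset (Fin 6)} {s : Node 6 n}, u ∈ subtorus F s →
      ¬ 2 < (gap F s ∅ u).card := fun hs => by
    have := card_gap_le_hammingDist hs (self_mem_subtorus ∅ u)
    rw [hammingDist_self] at this
    omega
  simp only [Finset.coe_insert, Finset.coe_singleton, Set.mem_insert_iff,
    Set.mem_singleton_iff] at hu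
  rcases hu with rfl | rfl | rfl | rfl
  · exact hzero (self_mem_subtorus _ _) h1.1
  · exact hzero h.mem_left h1.1
  · exact hzero (self_mem_subtorus _ _) h1.2
  · exact hzero h.mem_right h1.2

theorem card_filter_gap_le {d : ℕ} (hn : 1 ≤ n) (F : Finset (Fin d)) (v : Node d n) :
    (Finset.univ.filter fun u : Node d n => (gap F v ∅ u).card ≤ 2).card ≤
      2 ^ d * n ^ (F.card + 2) := by
  have hsub : (Finset.univ.filter fun u : Node d n => (gap F v ∅ u).card ≤ 2) ⊆
      (Finset.univ.filter fun D : Finset (Fin d) => D.card ≤ 2).biUnion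
        fun D => subtorusFinset (F ∪ D) v := by
    intro u hu
    refine Finset.mem_biUnion.2 ⟨gap F v ∅ u, by simpa using hu, mem_subtorusFinset.2 ?_⟩
    intro l hl
    simp only [Finset.mem_union, mem_gap, Finset.notMem_empty, not_false_eq_true, true_and, not_or,
      not_and, not_not] at hl
    exact (hl.2 hl.1).symm
  refine (Finset.card_le_card hsub).trans ((Finset.card_biUnion_le_card_mul _ _
    (n ^ (F.card + 2)) fun D hD => ?_).trans (Nat.mul_le_mul_right _ ?_))
  · rw [card_subtorusFinset]
    refine Nat.pow_le_pow_right hn ((Finset.card_union_le _ _).trans ?_)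
    have := (Finset.mem_filter.1 hD).2
    omega
  · refine (Finset.card_filter_le _ _).trans ?_
    simp

/-- The sparse event follows from avoiding at most `64 n ^ 8` pairs and `128 n ^ 4` single nodes.
These are decreasing events, so Harris' inequality allows multiplication; for `p` of order `n ^
(-4)` both factors stay bounded below. -/
theorem le_setBernoulli_real_sparseEvent (hn : 1 ≤ n) (p : unitInterval) (x z : Node 6 n) :
    (1 - (p : ℝ) ^ 2) ^ (64 * n ^ 8) * (1 - (p : ℝ)) ^ (128 * n ^ 4) ≤
      (setBernoulli Set.univ p).real (sparseEvent x z) := by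
  classical
  let 𝒮 : Finset (Finset (Node 6 n)) :=
    ((Finset.univ.sigma fun u : Node 6 n => Finset.univ.filter fun v : Node 6 n =>
      (gap ∅ u ∅ v).card ≤ 2).filter fun q => q.1 ≠ q.2).image fun q => {q.1, q.2}
  let 𝒯 : Finset (Finset (Node 6 n)) :=
    ((Finset.univ.filter fun u : Node 6 n => (gap {0, 1} x ∅ u).card ≤ 2) ∪
      Finset.univ.filter fun u : Node 6 n => (gap {2, 3} z ∅ u).card ≤ 2).image fun u => {u}
  have h𝒮 : 𝒮.card ≤ 64 * n ^ 8 := by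
    refine Finset.card_image_le.trans ((Finset.card_filter_le _ _).trans ?_)
    rw [Finset.card_sigma]
    refine (Finset.sum_le_card_nsmul _ _ (2 ^ 6 * n ^ 2)
      fun u _ => by simpa using card_filter_gap_le hn ∅ u).trans_eq ?_
    simp
    ring
  have h𝒯 : 𝒯.card ≤ 128 * n ^ 4 := by
    refine Finset.card_image_le.trans ((Finset.card_union_le _ _).trans ?_)
    have h1 := card_filter_gap_le hn {0, 1} x
    have h2 := card_filter_gap_le hn {2, 3} z
    have h3 : ({0, 1} : Finset (Fin 6)).card = 2 := by decide
    have h4 : ({2, 3} : Finset (Fin 6)).card = 2 := by decide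
    rw [h3] at h1
    rw [h4] at h2
    norm_num only at h1 h2
    omega
  have hp0 : (0 : ℝ) ≤ p := p.2.1
  have hp1 : (p : ℝ) ≤ 1 := p.2.2
  have e1 := one_sub_pow_le_setBernoulli_real p 2 𝒮 fun S hS => by
    obtain ⟨q, hq, rfl⟩ := Finset.mem_image.1 hS
    exact Finset.card_pair (Finset.mem_filter.1 hq).2
  have e2 := one_sub_pow_le_setBernoulli_real p 1 𝒯 fun S hS => by
    obtain ⟨q, hq, rfl⟩ := Finset.mem_image.1 hS
    exact Finset.card_singleton q
  rw [pow_one] at e2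
  have hlow : ∀ 𝒰 : Finset (Finset (Node 6 n)),
      IsLowerSet {ω : Set (Node 6 n) | ∀ S ∈ 𝒰, ¬ (S : Set (Node 6 n)) ⊆ ω} :=
    fun 𝒰 _ _ hle h S hS h' => h S hS (h'.trans hle)
  have hs0 : 0 ≤ 1 - (p : ℝ) ^ 2 := sub_nonneg.2 (pow_le_one₀ hp0 hp1)
  have hs1 : 0 ≤ 1 - (p : ℝ) := sub_nonneg.2 hp1
  calc _ ≤ (1 - (p : ℝ) ^ 2) ^ 𝒮.card * (1 - (p : ℝ)) ^ 𝒯.card :=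
        mul_le_mul (pow_le_pow_of_le_one hs0 (sub_le_self _ (by positivity)) h𝒮)
          (pow_le_pow_of_le_one hs1 (sub_le_self _ hp0) h𝒯) (by positivity) (by positivity)
    _ ≤ _ := mul_le_mul e1 e2 (by positivity) measureReal_nonneg
    _ ≤ _ := setBernoulli_real_mul_le p (hlow 𝒮) (hlow 𝒯)
    _ ≤ _ := by
      refine measureReal_mono ?_ (measure_ne_top _ _)
      rintro ω ⟨h1, h2⟩
      refine ⟨fun u hu v hv huv => ?_, fun u hu => ?_⟩
      · by_contra hle
        refine h1 {u, v} (Finset.mem_image.2 ⟨⟨u, v⟩, ?_, rfl⟩) (by simp [Set.insert_subset_iff, *])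
        simp only [Finset.mem_filter, Finset.mem_sigma, Finset.mem_univ, true_and]
        exact ⟨(card_gap_le_hammingDist (self_mem_subtorus _ _) (self_mem_subtorus _ _)).trans
          (not_lt.1 hle), huv⟩
      · by_contra hle
        refine h2 {u} (Finset.mem_image.2 ⟨u, ?_, rfl⟩) (by simpa using hu)
        simp only [Finset.mem_union, Finset.mem_filter, Finset.mem_univ, true_and]
        omega

theorem pow_sixteen_le_card_isTwoPairs [DecidablePred fun t : Node 6 n × Node 6 n × Node 6 n ×
    Node 6 n => IsTwoPairs t.1 t.2.1 t.2.2.1 t.2.2.2] {m : ℕ} (hm : 2 * m ≤ n) :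
    m ^ 16 ≤ (Finset.univ.filter fun t : Node 6 n × Node 6 n × Node 6 n × Node 6 n =>
      IsTwoPairs t.1 t.2.1 t.2.2.1 t.2.2.2).card := by
  let lo : Fin m → Fin n := fun k => ⟨k, by omega⟩
  let hi : Fin m → Fin n := fun k => ⟨m + k, by omega⟩
  have hlt : ∀ j k, lo j < hi k := fun j k => by
    simp only [lo, hi, Fin.mk_lt_mk]
    omega
  have hlo : ∀ j k, lo j = lo k → j = k := fun j k h => by
    simpa [lo, Fin.ext_iff] using h
  have hhi : ∀ j k, hi j = hi k → j = k := fun j k h => by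
    simpa [hi, Fin.ext_iff] using h
  -- Of the 24 coordinates, 16 are free: six for `x`, two more for `y`, and likewise for `z` and
  -- `w`. Values from the lower or upper half enforce all required inequalities.
  let f : (Fin 16 → Fin m) → Node 6 n × Node 6 n × Node 6 n × Node 6 n := fun c =>
    (![lo (c 0), hi (c 1), lo (c 2), lo (c 3), lo (c 4), lo (c 5)],
      ![hi (c 6), lo (c 7), lo (c 2), lo (c 3), lo (c 4), lo (c 5)],
      ![lo (c 8), lo (c 9), lo (c 10), hi (c 11), hi (c 12), hi (c 13)],
      ![lo (c 8), lo (c 9), hi (c 14), lo (c 15), hi (c 12), hi (c 13)])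
  have hinj : Function.Injective f := by
    intro c c' h
    have hx := congrArg Prod.fst h
    have hy := congrArg (fun t => t.2.1) h
    have hz := congrArg (fun t => t.2.2.1) h
    have hw := congrArg (fun t => t.2.2.2) h
    funext i
    fin_cases i
    · exact hlo _ _ (congrFun hx 0)
    · exact hhi _ _ (congrFun hx 1)
    · exact hlo _ _ (congrFun hx 2)
    · exact hlo _ _ (congrFun hx 3)
    · exact hlo _ _ (congrFun hx 4)
    · exact hlo _ _ (congrFun hx 5)
    · exact hhi _ _ (congrFun hy 0)
    · exact hlo _ _ (congrFun hy 1)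
    · exact hlo _ _ (congrFun hz 0)
    · exact hlo _ _ (congrFun hz 1)
    · exact hlo _ _ (congrFun hz 2)
    · exact hhi _ _ (congrFun hz 3)
    · exact hhi _ _ (congrFun hz 4)
    · exact hhi _ _ (congrFun hz 5)
    · exact hhi _ _ (congrFun hw 2)
    · exact hlo _ _ (congrFun hw 3)
  calc m ^ 16 = (Finset.univ.image f).card := by
        rw [Finset.card_image_of_injective _ hinj]
        simp
    _ ≤ _ := by
      refine Finset.card_le_card fun t ht => ?_
      obtain ⟨c, -, rfl⟩ := Finset.mem_image.1 ht
      refine Finset.mem_filter.2 ⟨Finset.mem_univ _, ?_⟩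
      refine ⟨fun l hl => ?_, hlt _ _, (hlt _ _).ne', fun l hl => ?_, hlt _ _, (hlt _ _).ne',
        (hlt _ _).ne, (hlt _ _).ne, (hlt _ _).ne', (hlt _ _).ne', (hlt _ _).ne, (hlt _ _).ne⟩
      · fin_cases l <;> first | rfl | exact absurd (by decide) hl
      · fin_cases l <;> first | rfl | exact absurd (by decide) hl

/-- Since a configuration determines its isolated two pairs, the events for different quadruples are
disjoint and their probabilities add. Each is bounded below by planting the four nodes in a sparse
configuration. -/
theorem le_real_spannedEvent_diff (hn : 2 ≤ n) (p : unitInterval) {m : ℕ} (hm : 2 * m ≤ n) :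
    (m : ℝ) ^ 16 * ((p : ℝ) ^ 4 *
        ((1 - (p : ℝ) ^ 2) ^ (64 * n ^ 8) * (1 - (p : ℝ)) ^ (128 * n ^ 4))) ≤
      (initialLaw 6 n p).real (spannedEvent 6 n 6 \ spannedEvent 6 n 4) := by
  classical
  have hp0 : (0 : ℝ) ≤ p := p.2.1
  have hp1 : (p : ℝ) ≤ 1 := p.2.2
  have hs0 : 0 ≤ 1 - (p : ℝ) ^ 2 := sub_nonneg.2 (pow_le_one₀ hp0 hp1)
  have hs1 : 0 ≤ 1 - (p : ℝ) := sub_nonneg.2 hp1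
  let Q := Finset.univ.filter fun t : Node 6 n × Node 6 n × Node 6 n × Node 6 n =>
    IsTwoPairs t.1 t.2.1 t.2.2.1 t.2.2.2
  let E : Node 6 n × Node 6 n × Node 6 n × Node 6 n → Set (Set (Node 6 n)) := fun t =>
    {ω | IsIsolated ω t.1 t.2.1 t.2.2.1 t.2.2.2}
  have hE : ∀ t ∈ Q, (p : ℝ) ^ 4 *
      ((1 - (p : ℝ) ^ 2) ^ (64 * n ^ 8) * (1 - (p : ℝ)) ^ (128 * n ^ 4)) ≤
        (setBernoulli Set.univ p).real (E t) := by
    rintro ⟨x, y, z, w⟩ ht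
    have h : IsTwoPairs x y z w := (Finset.mem_filter.1 ht).2
    calc _ ≤ (p : ℝ) ^ 4 * (setBernoulli Set.univ p).real (sparseEvent x z) :=
          mul_le_mul_of_nonneg_left (le_setBernoulli_real_sparseEvent (by omega) p x z)
            (by positivity)
      _ ≤ (setBernoulli Set.univ p).real ((fun ω =>
          (({x, y, z, w} : Finset (Node 6 n)) : Set (Node 6 n)) ∪ ω) '' sparseEvent x z) := by
          have := pow_mul_setBernoulli_real_le p {x, y, z, w} (𝒟 := sparseEvent x z)
            fun ω hω => h.disjoint_of_mem_sparseEvent hω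
          rwa [h.card_eq_four] at this
      _ ≤ _ := by
          refine measureReal_mono ?_ (measure_ne_top _ _)
          rintro _ ⟨ω, hω, rfl⟩
          exact h.isIsolated_union hω
  have hdisj : (Q : Set _).PairwiseDisjoint E := by
    rintro ⟨x, y, z, w⟩ ht ⟨x', y', z', w'⟩ ht' hne
    refine Set.disjoint_left.2 fun ω hω hω' => hne ?_
    obtain ⟨rfl, rfl, rfl, rfl⟩ := IsIsolated.eq_of_isTwoPairs hω (Finset.mem_filter.1 ht).2 hω'
      (Finset.mem_filter.1 ht').2
    rfl
  calc _ ≤ (Q.card : ℝ) * ((p : ℝ) ^ 4 *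
          ((1 - (p : ℝ) ^ 2) ^ (64 * n ^ 8) * (1 - (p : ℝ)) ^ (128 * n ^ 4))) :=
        mul_le_mul_of_nonneg_right (by exact_mod_cast pow_sixteen_le_card_isTwoPairs hm)
          (by positivity)
    _ ≤ ∑ t ∈ Q, (setBernoulli Set.univ p).real (E t) := by
        rw [← nsmul_eq_mul]
        exact Finset.card_nsmul_le_sum _ _ _ hE
    _ = (setBernoulli Set.univ p).real (⋃ t ∈ Q, E t) :=
        (measureReal_biUnion_finset hdisj fun t _ => (Set.toFinite _).measurableSet).symm
    _ ≤ _ := by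
        refine measureReal_mono ?_ (measure_ne_top _ _)
        refine Set.iUnion₂_subset fun t ht ω hω => ?_
        exact IsIsolated.mem_spannedEvent_diff hn hω (Finset.mem_filter.1 ht).2

theorem exp_neg_two_mul_le_one_sub {x : ℝ} (h0 : 0 ≤ x) (h1 : x ≤ 1 / 2) :
    Real.exp (-(2 * x)) ≤ 1 - x := by
  rw [Real.exp_neg]
  refine inv_le_of_inv_le₀ (by linarith) ?_
  rw [inv_le_iff_one_le_mul₀ (by linarith)]
  have := Real.add_one_le_exp (2 * x)
  nlinarith

theorem exists_lt_real_spannedEvent_diff (a : ℝ) (ha : 0 < a) :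
    ∃ c : ℝ, 0 < c ∧ ∃ N : ℕ, ∀ n ≥ N, ∀ p : unitInterval, (p : ℝ) = a * (n : ℝ) ^ (-4 : ℤ) →
      c < (initialLaw 6 n p).real (spannedEvent 6 n 6 \ spannedEvent 6 n 4) := by
  have hc : 0 < a ^ 4 / 3 ^ 16 * (Real.exp (-(128 * a ^ 2)) * Real.exp (-(256 * a))) := by
    positivity
  -- Halving makes the inequality strict; `n ≥ 2a` ensures `p ≤ 1/2`, needed for the exponential
  -- bounds on `1 - p` and `1 - p ^ 2`.
  refine ⟨_, half_pos hc, max 2 ⌈2 * a⌉₊, fun n hn p hp => (half_lt_self hc).trans_le ?_⟩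
  have hn2 : 2 ≤ n := (le_max_left _ _).trans hn
  have hna : 2 * a ≤ n := (Nat.le_ceil _).trans (by exact_mod_cast (le_max_right _ _).trans hn)
  have hn0 : (0 : ℝ) < n := by positivity
  have hn1 : (1 : ℝ) ≤ n := by exact_mod_cast (by omega : 1 ≤ n)
  have hpn : (p : ℝ) * n ^ 4 = a := by
    rw [hp, mul_assoc, zpow_neg]
    have : (n : ℝ) ^ (4 : ℤ) = (n : ℝ) ^ 4 := by norm_cast
    rw [this, inv_mul_cancel₀ (by positivity), mul_one]
  have hp0 : (0 : ℝ) ≤ p := p.2.1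
  have hp1 : (p : ℝ) ≤ 1 := p.2.2
  have hp2 : (p : ℝ) ≤ 1 / 2 := by
    have h1 : (n : ℝ) ≤ n ^ 4 := le_self_pow₀ hn1 (by norm_num)
    nlinarith [mul_le_mul_of_nonneg_left h1 hp0]
  have hpp : (p : ℝ) ^ 2 ≤ 1 / 2 := by nlinarith
  refine le_trans ?_ (le_real_spannedEvent_diff hn2 p (m := n / 2) (by omega))
  have e1 : Real.exp (-(128 * a ^ 2)) ≤ (1 - (p : ℝ) ^ 2) ^ (64 * n ^ 8) := by
    refine le_trans (le_of_eq ?_) (pow_le_pow_left₀ (Real.exp_pos _).le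
      (exp_neg_two_mul_le_one_sub (sq_nonneg _) hpp) _)
    rw [← Real.exp_nat_mul, ← hpn]
    congr 1
    push_cast
    ring
  have e2 : Real.exp (-(256 * a)) ≤ (1 - (p : ℝ)) ^ (128 * n ^ 4) := by
    refine le_trans (le_of_eq ?_) (pow_le_pow_left₀ (Real.exp_pos _).le
      (exp_neg_two_mul_le_one_sub hp0 hp2) _)
    rw [← Real.exp_nat_mul, ← hpn]
    congr 1
    push_cast
    ring
  -- Rounding `n / 2` down still leaves at least `n / 3` for `n ≥ 2`, and `n ^ 16 * p ^ 4 = a ^ 4`.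
  have e3 : a ^ 4 / 3 ^ 16 ≤ ((n / 2 : ℕ) : ℝ) ^ 16 * (p : ℝ) ^ 4 := by
    have h3 : (n : ℝ) / 3 ≤ ((n / 2 : ℕ) : ℝ) := by
      rw [div_le_iff₀ (by norm_num)]
      exact_mod_cast (by omega : n ≤ n / 2 * 3)
    refine le_trans (le_of_eq ?_) (mul_le_mul_of_nonneg_right
      (pow_le_pow_left₀ (by positivity) h3 16) (by positivity))
    rw [← hpn]
    ring
  rw [← mul_assoc (((n / 2 : ℕ) : ℝ) ^ 16)]
  exact mul_le_mul e3 (mul_le_mul e1 e2 (Real.exp_pos _).le ((Real.exp_pos _).le.trans e1))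
    (by positivity) (by positivity)

end SixDimensional

end HammingBootstrap

theorem mainTheorem5 (J : ℕ) (hJ : 1 ≤ J) (a : ℝ) (ha : 0 < a) (p : ℕ → unitInterval)
    (hp : ∀ᶠ n : ℕ in atTop, (p n : ℝ) = a * (n : ℝ) ^ (-2 * (J : ℤ) - 2)) :
    (1 < J →
      Tendsto (fun n : ℕ =>
          (HammingBootstrap.initialLaw ((J + 1) * (J + 2)) n (p n)).real
            (HammingBootstrap.spannedEvent ((J + 1) * (J + 2)) n ((J + 1) * (J + 2)) \
              HammingBootstrap.spannedEvent ((J + 1) * (J + 2)) n (2 * J + 2)))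
        atTop (𝓝 0)) ∧
    (J = 1 →
      ∃ c : ℝ, 0 < c ∧ ∀ᶠ n : ℕ in atTop,
        c < (HammingBootstrap.initialLaw 6 n (p n)).real
          (HammingBootstrap.spannedEvent 6 n 6 \ HammingBootstrap.spannedEvent 6 n 4)) := by
  refine ⟨fun hJ1 => ?_, ?_⟩
  · obtain ⟨K, hK⟩ := HammingBootstrap.exists_real_spannedEvent_diff_le J hJ1 a
    refine squeeze_zero' (Eventually.of_forall fun n => measureReal_nonneg)
      (g := fun n : ℕ => K * (n : ℝ)⁻¹) ?_ ?_
    · filter_upwards [hp, eventually_ge_atTop 2] with n hpn hn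
      exact hK n hn (p n) hpn
    · simpa using (tendsto_inv_atTop_nhds_zero_nat (𝕜 := ℝ)).const_mul K
  · rintro rfl
    obtain ⟨c, hc, N, hN⟩ := HammingBootstrap.exists_lt_real_spannedEvent_diff a ha
    refine ⟨c, hc, ?_⟩
    filter_upwards [hp, eventually_ge_atTop N] with n hpn hn
    exact hN n hn (p n) (by simpa using hpn)
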